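/- Let $\Xi$ be a Hausdorff, locally compact, $\sigma$-compact topological groupoid with unit space $X$, source map ${\rm d}$ and range map ${\rm r}$, endowed with a right Haar system $\lambda=\{\lambda_x\mid x\in X\}$ (regular Borel measures on the fibres $\Xi_x={\rm d}^{-1}(x)$ with full support, such that $x\mapsto\int_{\Xi_x} f\,d\lambda_x$ is continuous for every $f\in C_c(\Xi)$, and such that for every $\xi\in\Xi$ the map $\eta\mapsto\eta\xi$ transports $\lambda_{{\rm r}(\xi)}$ to $\lambda_{{\rm d}(\xi)}$), and with a continuous normalized $2$-cocycle $\omega:\Xi^{(2)}\to\mathbb T$, that is, $\omega(\xi,\eta)\,\omega(\xi\eta,\zeta)=\omega(\eta,\zeta)\,\omega(\xi,\eta\zeta)$ whenever the products are defined, and $\omega=1$ if one of the arguments is a unit. For $x\in X$ and $f\in C_c(\Xi)$ let $\Pi_x(f)$ be the bounded operator on $\mathcal H_x=L^2(\Xi_x;\lambda_x)$ given by $$[\Pi_x(f)u](\xi)=\int_{\Xi_x} f(\xi\eta^{-1})\,u(\eta)\,\omega(\xi\eta^{-1},\eta)\,d\lambda_x(\eta),$$ let ${\sf C}^*_{\rm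 r}(\Xi,\omega)$ be the completion of the $^*$-algebra $C_c(\Xi)$ (with the twisted convolution and involution, for which every $\Pi_x$ is a $^*$-representation) in the norm $\|f\|=\sup_{x\in X}\|\Pi_x(f)\|$, and denote again by $\Pi_x:{\sf C}^*_{\rm r}(\Xi,\omega)\to\mathbb B(\mathcal H_x)$ the extended representation. Assume that $\Xi$ is topologically transitive, i.e. that at least one orbit is dense in $X$. Then for every unit $x\in X$ the following assertions are equivalent: (i) the orbit $\mathcal O_x={\rm r}(\Xi_x)$ of $x$ is dense in $X$; (ii) the representation $\Pi_x$ of ${\sf C}^*_{\rm r}(\Xi,\omega)$ is faithful (injective); (iii) for every normal element $f$ of ${\sf C}^*_{\rm r}(\Xi,\omega)$ one has ${\sf sp}[\Pi_x(f)]={\sf sp}(f)$, where ${\sf sp}[\Pi_x(f)]$ is the spectrum in $\mathbb B(\mathcal H_x)$ and ${\sf sp}(f)$ is the spectrum of $f$ in the multiplier $C^*$-algebra of ${\sf C}^*_{\rm r}(\Xi,\omega)$ (which is ${\sf C}^*_{\rm r}(\Xi,\omega)$ itself if this algebra is unital). -/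

import Mathlib

open CategoryTheory MeasureTheory Filter Topology
open scoped ENNReal CompactlySupported MultiplierAlgebra

noncomputable section

namespace TwistedGroupoid

universe v u

/-! ### Topological groupoids

A groupoid `Ξ` over the unit space `X` is a category structure on `X` in which all morphisms are
invertible.  An element `ξ ∈ Ξ` with `d(ξ) = x` and `r(ξ) = y` is a morphism `x ⟶ y`, and the
product `ξη`, defined when `d(ξ) = r(η)`, is `η ≫ ξ` in Mathlib's notation. -/

/-- The total space `Ξ` of all arrows of a groupoid with unit space `X`. -/
structure Arrows (X : Type u) [Groupoid.{v} X] : Type (max u v) where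
  /-- the source `d(ξ)` -/
  {d : X}
  /-- the range `r(ξ)` -/
  {r : X}
  /-- the underlying morphism -/
  hom : d ⟶ r

/-- The set `Ξ⁽²⁾` of composable pairs `(ξ, η)`, `d(ξ) = r(η)`. -/
structure Composable (X : Type u) [Groupoid.{v} X] : Type (max u v) where
  {x : X}
  {y : X}
  {z : X}
  /-- the left factor `ξ` -/
  left : y ⟶ z
  /-- the right factor `η` -/
  right : x ⟶ y

/-- The `d`-fibre `Ξ_x = {ξ ∈ Ξ ∣ d(ξ) = x}`. -/
structure Fiber {X : Type u} [Groupoid.{v} X] (x : X) : Type (max u v) where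
  /-- the range `r(ξ)` -/
  {r : X}
  /-- the underlying morphism -/
  hom : x ⟶ r

section Basic

variable {X : Type u} [Groupoid.{v} X]

/-- The unit `x ∈ X`, seen as an element of `Ξ`. -/
def Arrows.unit (x : X) : Arrows X := ⟨𝟙 x⟩

/-- The inverse `ξ⁻¹`. -/
def Arrows.inv (ξ : Arrows X) : Arrows X := ⟨Groupoid.inv ξ.hom⟩

/-- The pair `(ξ, η)` underlying an element of `Ξ⁽²⁾`. -/
def Composable.toProd (p : Composable X) : Arrows X × Arrows X := (⟨p.left⟩, ⟨p.right⟩)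

/-- The product `ξη` of a composable pair `(ξ, η)`. -/
def Composable.mul (p : Composable X) : Arrows X := ⟨p.right ≫ p.left⟩

/-- The inclusion of `Ξ_x` in `Ξ`. -/
def Fiber.toArrows {x : X} (ξ : Fiber x) : Arrows X := ⟨ξ.hom⟩

/-- Right translation `Ξ_{r(ξ)} ∋ η ↦ ηξ ∈ Ξ_{d(ξ)}`. -/
def Fiber.mulRight {x y : X} (ξ : x ⟶ y) (η : Fiber y) : Fiber x := ⟨ξ ≫ η.hom⟩

/-- The composable pair `(ξη⁻¹, η)` attached to `ξ, η ∈ Ξ_x`. -/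
def Fiber.quotPair {x : X} (ξ η : Fiber x) : Composable X :=
  ⟨Groupoid.inv η.hom ≫ ξ.hom, η.hom⟩

/-- The element `ξη⁻¹ ∈ Ξ` attached to `ξ, η ∈ Ξ_x`. -/
def Fiber.quot {x : X} (ξ η : Fiber x) : Arrows X := ⟨Groupoid.inv η.hom ≫ ξ.hom⟩

/-- The orbit `𝒪_x = r(Ξ_x)` of a unit. -/
def orbit (x : X) : Set X := Set.range (fun ξ : Fiber x => ξ.r)

variable [TopologicalSpace (Arrows X)]

/-- `Ξ⁽²⁾` has the topology of a subspace of `Ξ × Ξ`. -/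
instance : TopologicalSpace (Composable X) := .induced Composable.toProd inferInstance

/-- `Ξ_x` has the topology of a subspace of `Ξ`. -/
instance (x : X) : TopologicalSpace (Fiber x) := .induced Fiber.toArrows inferInstance

/-- `Ξ_x` carries its Borel `σ`-algebra. -/
instance (x : X) : MeasurableSpace (Fiber x) := borel _

instance (x : X) : BorelSpace (Fiber x) := ⟨rfl⟩

end Basic

/-- A topological groupoid: all structure maps are continuous.  (Continuity of `unit` and `d` says
in particular that `X` has the topology induced by `Ξ`.) -/
class IsTopologicalGroupoid (X : Type u) [Groupoid.{v} X] [TopologicalSpace X]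
    [TopologicalSpace (Arrows X)] : Prop where
  continuous_d : Continuous (fun ξ : Arrows X => ξ.d)
  continuous_r : Continuous (fun ξ : Arrows X => ξ.r)
  continuous_unit : Continuous (Arrows.unit : X → Arrows X)
  continuous_inv : Continuous (Arrows.inv : Arrows X → Arrows X)
  continuous_mul : Continuous (Composable.mul : Composable X → Arrows X)

/-- There is at least one dense orbit. -/
def IsTopologicallyTransitive (X : Type u) [Groupoid.{v} X] [TopologicalSpace X] : Prop :=
  ∃ x : X, Dense (orbit x)

/-- A right Haar system: a family of regular Borel measures `λ_x` on the fibres `Ξ_x` with full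
support, depending continuously on `x` and invariant under right translations. -/
structure RightHaarSystem (X : Type u) [Groupoid.{v} X] [TopologicalSpace X]
    [TopologicalSpace (Arrows X)] where
  /-- the measure `λ_x` on `Ξ_x` -/
  measure (x : X) : Measure (Fiber x)
  regular (x : X) : (measure x).Regular
  fullSupport (x : X) : (measure x).IsOpenPosMeasure
  continuous_integral (f : Arrows X → ℂ) : Continuous f → HasCompactSupport f →
    Continuous (fun x => ∫ ξ : Fiber x, f ξ.toArrows ∂(measure x))
  map_mulRight {x y : X} (ξ : x ⟶ y) : (measure y).map (Fiber.mulRight ξ) = measure x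

/-- A continuous normalized `2`-cocycle `ω : Ξ⁽²⁾ → 𝕋`; `ω ⟨ξ, η⟩` is `ω(ξ, η)`. -/
structure TwoCocycle (X : Type u) [Groupoid.{v} X] [TopologicalSpace (Arrows X)] where
  /-- the function `ω` -/
  toFun : Composable X → Circle
  continuous_toFun : Continuous toFun
  cocycle {w x y z : X} (ξ : y ⟶ z) (η : x ⟶ y) (ζ : w ⟶ x) :
    toFun ⟨ξ, η⟩ * toFun ⟨η ≫ ξ, ζ⟩ = toFun ⟨η, ζ⟩ * toFun ⟨ξ, ζ ≫ η⟩
  unit_left {x y : X} (η : x ⟶ y) : toFun ⟨𝟙 y, η⟩ = 1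
  unit_right {x y : X} (ξ : x ⟶ y) : toFun ⟨ξ, 𝟙 x⟩ = 1

attribute [instance] RightHaarSystem.regular RightHaarSystem.fullSupport

/-! ### Analytic preliminaries -/

/-- A Cauchy-Schwarz inequality. -/
theorem norm_integral_mul_sq_le {Y : Type*} [TopologicalSpace Y] [MeasurableSpace Y]
    [BorelSpace Y] (μ : Measure Y) [IsFiniteMeasureOnCompacts μ] {k u : Y → ℂ} (hk : Continuous k)
    (hkc : HasCompactSupport k) (hu : Continuous u) :
    ‖∫ η, k η * u η ∂μ‖ ^ 2 ≤ (∫ η, ‖k η‖ ∂μ) * ∫ η, ‖k η‖ * ‖u η‖ ^ 2 ∂μ := by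
  have hs : HasCompactSupport (fun η => √‖k η‖) :=
    hkc.comp_left (g := fun z => √‖z‖) (by simp)
  have hsc : Continuous (fun η => √‖k η‖) := by fun_prop
  have h1 : MemLp (fun η => √‖k η‖) (ENNReal.ofReal 2) μ := hsc.memLp_of_hasCompactSupport hs
  have h2 : MemLp (fun η => √‖k η‖ * ‖u η‖) (ENNReal.ofReal 2) μ :=
    (hsc.mul hu.norm).memLp_of_hasCompactSupport hs.mul_right
  have h := integral_mul_le_Lp_mul_Lq_of_nonneg (μ := μ) Real.HolderConjugate.two_two
    (f := fun η => √‖k η‖) (g := fun η => √‖k η‖ * ‖u η‖)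
    (ae_of_all _ fun η => by positivity) (ae_of_all _ fun η => by positivity) h1 h2
  have e1 : ∀ η, √‖k η‖ * (√‖k η‖ * ‖u η‖) = ‖k η * u η‖ := fun η => by
    rw [← mul_assoc, Real.mul_self_sqrt (norm_nonneg _), norm_mul]
  have e2 : ∀ η, √‖k η‖ ^ (2 : ℝ) = ‖k η‖ := fun η => by
    rw [Real.rpow_two, Real.sq_sqrt (norm_nonneg _)]
  have e3 : ∀ η, (√‖k η‖ * ‖u η‖) ^ (2 : ℝ) = ‖k η‖ * ‖u η‖ ^ 2 := fun η => by
    rw [Real.rpow_two, mul_pow, Real.sq_sqrt (norm_nonneg _)]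
  simp only [e1, e2, e3, ← Real.sqrt_eq_rpow] at h
  have h' := (norm_integral_le_integral_norm (μ := μ) fun η => k η * u η).trans h
  rw [← Real.sqrt_mul (integral_nonneg fun η => norm_nonneg _)] at h'
  exact (Real.le_sqrt (norm_nonneg _) (mul_nonneg (integral_nonneg fun _ => by positivity)
    (integral_nonneg fun _ => by positivity))).1 h'

/-- Schur's test for a continuous, properly supported kernel. -/
theorem schur_test {Y : Type*} [TopologicalSpace Y] [T2Space Y] [LocallyCompactSpace Y]
    [NormalSpace Y] [MeasurableSpace Y] [BorelSpace Y] (μ : Measure Y) [μ.Regular] {k : Y → Y → ℂ}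
    (hk : Continuous k.uncurry)
    (hl : ∀ L : Set Y, IsCompact L → ∃ L' : Set Y, IsCompact L' ∧
      ∀ ξ η, η ∈ L → k ξ η ≠ 0 → ξ ∈ L')
    (hr : ∀ L : Set Y, IsCompact L → ∃ L' : Set Y, IsCompact L' ∧
      ∀ ξ η, ξ ∈ L → k ξ η ≠ 0 → η ∈ L')
    {A : ℝ} (hA : 0 ≤ A) (h1 : ∀ ξ, ∫ η, ‖k ξ η‖ ∂μ ≤ A) (h2 : ∀ η, ∫ ξ, ‖k ξ η‖ ∂μ ≤ A)
    {u : Y → ℂ} (hu : MemLp u 2 μ) :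
    MemLp (fun ξ => ∫ η, k ξ η * u η ∂μ) 2 μ ∧
      eLpNorm (fun ξ => ∫ η, k ξ η * u η ∂μ) 2 μ ≤ ENNReal.ofReal A * eLpNorm u 2 μ ∧
      ∀ ξ, Integrable (fun η => k ξ η * u η) μ := by
  have hkξ : ∀ ξ, Continuous (k ξ) := fun ξ => hk.comp (Continuous.prodMk_right ξ)
  have hkc : ∀ ξ, HasCompactSupport (k ξ) := fun ξ => by
    obtain ⟨L', hL', h⟩ := hr {ξ} isCompact_singleton
    exact HasCompactSupport.intro hL' fun η hη => by
      by_contra h0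
      exact hη (h ξ η rfl h0)
  have hkm : ∀ ξ, MemLp (k ξ) 2 μ := fun ξ => (hkξ ξ).memLp_of_hasCompactSupport (hkc ξ)
  have hint : ∀ (w : Y → ℂ), MemLp w 2 μ → ∀ ξ, Integrable (fun η => k ξ η * w η) μ :=
    fun w hw ξ => (hkm ξ).integrable_mul hw
  -- the case of continuous, compactly supported functions
  have key : ∀ w : Y → ℂ, Continuous w → HasCompactSupport w →
      MemLp (fun ξ => ∫ η, k ξ η * w η ∂μ) 2 μ ∧
      eLpNorm (fun ξ => ∫ η, k ξ η * w η ∂μ) 2 μ ≤ ENNReal.ofReal A * eLpNorm w 2 μ := by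
    intro w hw hwc
    obtain ⟨L', hL', hL⟩ := hl _ hwc
    have hcont : Continuous (fun ξ => ∫ η, k ξ η * w η ∂μ) := by
      rw [← continuousOn_univ]
      refine continuousOn_integral_of_compact_support hwc
        (Continuous.continuousOn (by
          have : Continuous (fun p : Y × Y => k p.1 p.2) := hk
          change Continuous (fun p : Y × Y => k p.1 p.2 * w p.2)
          fun_prop)) ?_
      intro p η _ hη
      simp [image_eq_zero_of_notMem_tsupport hη]
    have hz : ∀ ξ η, ξ ∉ L' → k ξ η * w η = 0 := fun ξ η hξ => by
      by_contra h0
      rw [mul_eq_zero, not_or] at h0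
      exact hξ (hL ξ η (subset_tsupport _ h0.2) h0.1)
    have hsupp : HasCompactSupport (fun ξ => ∫ η, k ξ η * w η ∂μ) :=
      HasCompactSupport.intro hL' fun ξ hξ => by simp [hz ξ _ hξ]
    refine ⟨hcont.memLp_of_hasCompactSupport hsupp, ?_⟩
    let G : Y → Y → ℝ := fun ξ η => ‖k ξ η‖ * ‖w η‖ ^ 2
    have hG : Continuous G.uncurry := by
      have : Continuous (fun p : Y × Y => k p.1 p.2) := hk
      change Continuous (fun p : Y × Y => ‖k p.1 p.2‖ * ‖w p.2‖ ^ 2)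
      fun_prop
    have hGz : ∀ ξ η, ξ ∉ L' → G ξ η = 0 := fun ξ η hξ => by
      rcases mul_eq_zero.1 (hz ξ η hξ) with h | h <;> simp [G, h]
    have hGz' : ∀ ξ η, η ∉ tsupport w → G ξ η = 0 := fun ξ η hη => by
      simp [G, image_eq_zero_of_notMem_tsupport hη]
    have hGc : HasCompactSupport G.uncurry := by
      refine HasCompactSupport.intro (hL'.prod hwc) ?_
      rintro ⟨ξ, η⟩ h
      by_cases hξ : ξ ∈ L'
      · exact hGz' ξ η fun hη => h ⟨hξ, hη⟩
      · exact hGz ξ η hξ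
    have hGi : Continuous (fun ξ => ∫ η, G ξ η ∂μ) := by
      rw [← continuousOn_univ]
      exact continuousOn_integral_of_compact_support hwc hG.continuousOn
        fun p η _ hη => hGz' p η hη
    have hGic : HasCompactSupport (fun ξ => ∫ η, G ξ η ∂μ) :=
      HasCompactSupport.intro hL' fun ξ hξ => by simp [hGz ξ _ hξ]
    have hwi : Integrable (fun η => ‖w η‖ ^ 2) μ := by
      have h1 : Continuous (fun η => ‖w η‖ ^ 2) := by fun_prop
      have h2 : HasCompactSupport (fun η => ‖w η‖ ^ 2) :=
        HasCompactSupport.intro hwc fun η hη => by simp [image_eq_zero_of_notMem_tsupport hη]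
      exact h1.integrable_of_hasCompactSupport h2
    have hfin : ∫ ξ, ‖∫ η, k ξ η * w η ∂μ‖ ^ 2 ∂μ ≤ A ^ 2 * ∫ η, ‖w η‖ ^ 2 ∂μ := by
      calc ∫ ξ, ‖∫ η, k ξ η * w η ∂μ‖ ^ 2 ∂μ ≤ ∫ ξ, A * ∫ η, G ξ η ∂μ ∂μ := by
            refine integral_mono_of_nonneg (ae_of_all _ fun ξ => sq_nonneg _)
              ((hGi.integrable_of_hasCompactSupport hGic).const_mul A)
              (ae_of_all _ fun ξ => ?_)
            change ‖∫ η, k ξ η * w η ∂μ‖ ^ 2 ≤ A * ∫ η, ‖k ξ η‖ * ‖w η‖ ^ 2 ∂μ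
            refine (norm_integral_mul_sq_le μ (hkξ ξ) (hkc ξ) hw).trans ?_
            exact mul_le_mul_of_nonneg_right (h1 ξ) (integral_nonneg fun η => by positivity)
        _ = A * ∫ η, ∫ ξ, G ξ η ∂μ ∂μ := by
            rw [integral_const_mul, integral_integral_swap_of_hasCompactSupport hG hGc]
        _ ≤ A * ∫ η, A * ‖w η‖ ^ 2 ∂μ := by
            refine mul_le_mul_of_nonneg_left ?_ hA
            refine integral_mono_of_nonneg
              (ae_of_all _ fun η => integral_nonneg fun ξ => by positivity)
              (hwi.const_mul A) (ae_of_all _ fun η => ?_)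
            simp only [G, integral_mul_const]
            exact mul_le_mul_of_nonneg_right (h2 η) (by positivity)
        _ = A ^ 2 * ∫ η, ‖w η‖ ^ 2 ∂μ := by rw [integral_const_mul]; ring
    have m1 : MemLp (fun ξ => ∫ η, k ξ η * w η ∂μ) 2 μ := hcont.memLp_of_hasCompactSupport hsupp
    have m2 : MemLp w 2 μ := hw.memLp_of_hasCompactSupport hwc
    rw [m1.eLpNorm_eq_integral_rpow_norm two_ne_zero ENNReal.ofNat_ne_top,
      m2.eLpNorm_eq_integral_rpow_norm two_ne_zero ENNReal.ofNat_ne_top, ← ENNReal.ofReal_mul hA]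
    refine ENNReal.ofReal_le_ofReal ?_
    simp only [ENNReal.toReal_ofNat, Real.rpow_two]
    rw [← one_div, ← Real.sqrt_eq_rpow, ← Real.sqrt_eq_rpow]
    calc _ ≤ √(A ^ 2 * ∫ η, ‖w η‖ ^ 2 ∂μ) := Real.sqrt_le_sqrt hfin
      _ = _ := by rw [Real.sqrt_mul (by positivity), Real.sqrt_sq hA]
  -- approximation
  have happ : ∀ n : ℕ, ∃ g : Y → ℂ, HasCompactSupport g ∧
      eLpNorm (u - g) 2 μ ≤ ((n : ℝ≥0∞) + 1)⁻¹ ∧ Continuous g ∧ MemLp g 2 μ := fun n =>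
    hu.exists_hasCompactSupport_eLpNorm_sub_le ENNReal.ofNat_ne_top (by simp)
  choose g hgc hgu hg hgm using happ
  have htend : Tendsto (fun n : ℕ => ((n : ℝ≥0∞) + 1)⁻¹) atTop (𝓝 0) := by
    have := ENNReal.tendsto_inv_nat_nhds_zero.comp (tendsto_add_atTop_nat 1)
    simpa [Function.comp_def] using this
  have hlim : ∀ ξ, Tendsto (fun n => ∫ η, k ξ η * g n η ∂μ) atTop
      (𝓝 (∫ η, k ξ η * u η ∂μ)) := by
    intro ξ
    refine tendsto_integral_of_L1 _ (hint u hu ξ).1 (Eventually.of_forall fun n => hint _ (hgm n) ξ)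
      ?_
    have hb : ∀ n, ∫⁻ η, ‖k ξ η * g n η - k ξ η * u η‖ₑ ∂μ ≤
        eLpNorm (k ξ) 2 μ * ((n : ℝ≥0∞) + 1)⁻¹ := fun n => by
      have := eLpNorm_smul_le_mul_eLpNorm (p := 2) (q := 2) (r := 1)
        ((hgm n).sub hu).aestronglyMeasurable (hkm ξ).aestronglyMeasurable
      rw [eLpNorm_one_eq_lintegral_enorm, eLpNorm_sub_comm] at this
      refine le_trans (le_of_eq ?_) (this.trans (by gcongr; exact hgu n))
      simp [mul_sub]
    refine tendsto_of_tendsto_of_tendsto_of_le_of_le tendsto_const_nhds ?_ (fun _ => bot_le) hb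
    simpa using ENNReal.Tendsto.const_mul htend (Or.inr (hkm ξ).2.ne)
  have hmeas : AEStronglyMeasurable (fun ξ => ∫ η, k ξ η * u η ∂μ) μ := by
    refine aestronglyMeasurable_of_tendsto_ae atTop (f := fun n ξ => ∫ η, k ξ η * g n η ∂μ)
      (fun n => (key _ (hg n) (hgc n)).1.aestronglyMeasurable) (ae_of_all _ hlim)
  have hle : eLpNorm (fun ξ => ∫ η, k ξ η * u η ∂μ) 2 μ ≤
      ENNReal.ofReal A * eLpNorm u 2 μ := by
    refine (Lp.eLpNorm_lim_le_liminf_eLpNorm (f := fun n ξ => ∫ η, k ξ η * g n η ∂μ)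
      (fun n => (key _ (hg n) (hgc n)).1.aestronglyMeasurable) _ (ae_of_all _ hlim)).trans ?_
    have hb : ∀ n, eLpNorm (fun ξ => ∫ η, k ξ η * g n η ∂μ) 2 μ ≤
        ENNReal.ofReal A * (eLpNorm u 2 μ + ((n : ℝ≥0∞) + 1)⁻¹) := fun n => by
      refine ((key _ (hg n) (hgc n)).2).trans ?_
      gcongr
      have := eLpNorm_sub_le (p := 2) hu.aestronglyMeasurable
        (hu.sub (hgm n)).aestronglyMeasurable (by norm_num)
      simp only [sub_sub_cancel] at this
      exact this.trans (by gcongr; exact hgu n)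
    have hl : Tendsto (fun n : ℕ => ENNReal.ofReal A * (eLpNorm u 2 μ + ((n : ℝ≥0∞) + 1)⁻¹)) atTop
        (𝓝 (ENNReal.ofReal A * eLpNorm u 2 μ)) := by
      have := ENNReal.Tendsto.const_mul (a := ENNReal.ofReal A)
        (tendsto_const_nhds (x := eLpNorm u 2 μ) |>.add htend) (Or.inr ENNReal.ofReal_ne_top)
      simpa using this
    exact (liminf_le_liminf (Eventually.of_forall hb)).trans hl.liminf_eq.le
  exact ⟨⟨hmeas, hle.trans_lt (ENNReal.mul_lt_top ENNReal.ofReal_lt_top hu.2)⟩, hle, hint u hu⟩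

/-! ### Topology of the fibres -/

section Fibers

variable {X : Type u} [Groupoid.{v} X]

lemma Fiber.toArrows_injective {x : X} :
    Function.Injective (Fiber.toArrows : Fiber x → Arrows X) := by
  rintro ⟨a⟩ ⟨b⟩ h
  simp only [Fiber.toArrows, Arrows.mk.injEq] at h
  obtain ⟨-, rfl, h⟩ := h
  obtain rfl := eq_of_heq h
  rfl

lemma Composable.toProd_injective :
    Function.Injective (Composable.toProd : Composable X → Arrows X × Arrows X) := by
  rintro ⟨a, b⟩ ⟨c, e⟩ h
  simp only [Composable.toProd, Prod.mk.injEq, Arrows.mk.injEq] at h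
  obtain ⟨⟨rfl, rfl, h1⟩, rfl, -, h2⟩ := h
  obtain rfl := eq_of_heq h1
  obtain rfl := eq_of_heq h2
  rfl

variable [TopologicalSpace (Arrows X)]

lemma Fiber.continuous_toArrows {x : X} : Continuous (Fiber.toArrows : Fiber x → Arrows X) :=
  continuous_induced_dom

variable [TopologicalSpace X] [IsTopologicalGroupoid X]

lemma continuous_quot {x : X} : Continuous (fun p : Fiber x × Fiber x => p.1.quot p.2) := by
  have h : Continuous (fun p : Fiber x × Fiber x =>
      (⟨p.1.hom, Groupoid.inv p.2.hom⟩ : Composable X)) := by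
    refine continuous_induced_rng.2 ?_
    exact (Fiber.continuous_toArrows.comp continuous_fst).prodMk
      (IsTopologicalGroupoid.continuous_inv.comp (Fiber.continuous_toArrows.comp continuous_snd))
  exact IsTopologicalGroupoid.continuous_mul.comp h

lemma continuous_quotPair {x : X} :
    Continuous (fun p : Fiber x × Fiber x => p.1.quotPair p.2) := by
  refine continuous_induced_rng.2 ?_
  exact continuous_quot.prodMk (Fiber.continuous_toArrows.comp continuous_snd)

lemma continuous_mulRight {x y : X} (ξ : x ⟶ y) :
    Continuous (Fiber.mulRight ξ : Fiber y → Fiber x) := by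
  refine continuous_induced_rng.2 ?_
  have h : Continuous (fun η : Fiber y => (⟨η.hom, ξ⟩ : Composable X)) := by
    refine continuous_induced_rng.2 ?_
    have h0 : Continuous (fun _ : Fiber y => (⟨ξ⟩ : Arrows X)) := continuous_const
    exact Fiber.continuous_toArrows.prodMk h0
  exact IsTopologicalGroupoid.continuous_mul.comp h

variable [T2Space (Arrows X)]

variable (X) in
lemma t2Space_units : T2Space X :=
  T2Space.of_injective_continuous (f := (Arrows.unit : X → Arrows X))
    (fun x y h => by simp only [Arrows.unit, Arrows.mk.injEq] at h; exact h.1)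
    IsTopologicalGroupoid.continuous_unit

lemma Fiber.isClosedEmbedding_toArrows {x : X} :
    IsClosedEmbedding (Fiber.toArrows : Fiber x → Arrows X) := by
  have := t2Space_units X
  refine ⟨⟨⟨rfl⟩, Fiber.toArrows_injective⟩, ?_⟩
  have h : Set.range (Fiber.toArrows : Fiber x → Arrows X) = (fun ξ : Arrows X => ξ.d) ⁻¹' {x} := by
    ext ξ
    constructor
    · rintro ⟨η, rfl⟩
      rfl
    · rcases ξ with ⟨ξ⟩
      rintro rfl
      exact ⟨⟨ξ⟩, rfl⟩
  rw [h]
  exact isClosed_singleton.preimage IsTopologicalGroupoid.continuous_d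

lemma Composable.isClosedEmbedding_toProd :
    IsClosedEmbedding (Composable.toProd : Composable X → Arrows X × Arrows X) := by
  have := t2Space_units X
  refine ⟨⟨⟨rfl⟩, Composable.toProd_injective⟩, ?_⟩
  have h : Set.range (Composable.toProd : Composable X → Arrows X × Arrows X) =
      {p | p.1.d = p.2.r} := by
    ext p
    constructor
    · rintro ⟨q, rfl⟩
      rfl
    · rcases p with ⟨⟨ξ⟩, ⟨η⟩⟩
      rintro (h : _ = _)
      dsimp only at h
      subst h
      exact ⟨⟨ξ, η⟩, rfl⟩
  rw [h]
  exact isClosed_eq (IsTopologicalGroupoid.continuous_d.comp continuous_fst)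
    (IsTopologicalGroupoid.continuous_r.comp continuous_snd)

instance (x : X) : T2Space (Fiber x) := Fiber.isClosedEmbedding_toArrows.isEmbedding.t2Space

instance (x : X) [LocallyCompactSpace (Arrows X)] : LocallyCompactSpace (Fiber x) :=
  Fiber.isClosedEmbedding_toArrows.locallyCompactSpace

instance (x : X) [SigmaCompactSpace (Arrows X)] : SigmaCompactSpace (Fiber x) :=
  Fiber.isClosedEmbedding_toArrows.sigmaCompactSpace

/-- Products of compact subsets of `Ξ` are compact. -/
lemma isCompact_image_mul {S L : Set (Arrows X)} (hS : IsCompact S) (hL : IsCompact L) :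
    IsCompact (Composable.mul '' (Composable.toProd ⁻¹' (S ×ˢ L))) :=
  (Composable.isClosedEmbedding_toProd.isCompact_preimage (hS.prod hL)).image
    IsTopologicalGroupoid.continuous_mul

end Fibers

/-! ### Regular representations -/

section Rep

variable {X : Type u} [Groupoid.{v} X] [TopologicalSpace (Arrows X)]

/-- The kernel `f(ξη⁻¹) ω(ξη⁻¹, η)` on `Ξ_x × Ξ_x`. -/
def kernel (ω : TwoCocycle X) (f : Arrows X → ℂ) {x : X} (ξ η : Fiber x) : ℂ :=
  f (ξ.quot η) * (ω.toFun (ξ.quotPair η) : ℂ)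

lemma norm_kernel (ω : TwoCocycle X) (f : Arrows X → ℂ) {x : X} (ξ η : Fiber x) :
    ‖kernel ω f ξ η‖ = ‖f (ξ.quot η)‖ := by
  rw [kernel, norm_mul, Circle.norm_coe, mul_one]

variable [TopologicalSpace X]

/-- The Hilbert space `ℋ_x = L²(Ξ_x; λ_x)`. -/
abbrev RightHaarSystem.H (haar : RightHaarSystem X) (x : X) : Type (max u v) :=
  Lp ℂ 2 (haar.measure x)

/-- The twisted convolution
`(f ⋆_ω u)(ξ) = ∫ f(ξη⁻¹) ω(ξη⁻¹, η) u(η) dλ_x(η)` of a function `f` on `Ξ` with a function `u` on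
the fibre `Ξ_x`. -/
def conv (haar : RightHaarSystem X) (ω : TwoCocycle X) (f : Arrows X → ℂ) {x : X}
    (u : Fiber x → ℂ) (ξ : Fiber x) : ℂ :=
  ∫ η : Fiber x, kernel ω f ξ η * u η ∂(haar.measure x)

variable [IsTopologicalGroupoid X]

lemma continuous_kernel (ω : TwoCocycle X) (f : C_c(Arrows X, ℂ)) (x : X) :
    Continuous (Function.uncurry (fun ξ η : Fiber x => kernel ω f ξ η)) :=
  (f.continuous.comp continuous_quot).mul
    (continuous_subtype_val.comp (ω.continuous_toFun.comp continuous_quotPair))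

/-- Integrals of a compactly supported function over the fibres are uniformly bounded. -/
lemma exists_bound_integral (haar : RightHaarSystem X) [T2Space (Arrows X)]
    (f : Arrows X → ℂ) (hf : Continuous f) (hfc : HasCompactSupport f) :
    ∃ A : ℝ, ∀ x : X, ∫ ξ : Fiber x, ‖f ξ.toArrows‖ ∂(haar.measure x) ≤ A := by
  have := t2Space_units X
  have h1 := haar.continuous_integral (fun ξ => (‖f ξ‖ : ℂ)) (by fun_prop)
    (HasCompactSupport.intro hfc fun ξ hξ => by simp [image_eq_zero_of_notMem_tsupport hξ])
  have h2 : HasCompactSupport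
      (fun x => ∫ ξ : Fiber x, (‖f ξ.toArrows‖ : ℂ) ∂(haar.measure x)) := by
    refine HasCompactSupport.intro (hfc.isCompact.image IsTopologicalGroupoid.continuous_d) ?_
    intro x hx
    have : ∀ ξ : Fiber x, f ξ.toArrows = 0 := fun ξ =>
      image_eq_zero_of_notMem_tsupport fun h => hx ⟨_, h, rfl⟩
    simp [this]
  obtain ⟨A, hA⟩ := h1.bounded_above_of_compact_support h2
  refine ⟨A, fun x => ?_⟩
  have h3 := hA x
  have h4 : ∫ ξ : Fiber x, (‖f ξ.toArrows‖ : ℂ) ∂(haar.measure x) =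
      ((∫ ξ : Fiber x, ‖f ξ.toArrows‖ ∂(haar.measure x) : ℝ) : ℂ) := integral_ofReal
  rw [h4, Complex.norm_real] at h3
  exact (le_abs_self _).trans h3

/-- The integrals of the kernel in each variable are bounded, uniformly in `x`. -/
lemma exists_bound_kernel (haar : RightHaarSystem X) (ω : TwoCocycle X) [T2Space (Arrows X)]
    (f : C_c(Arrows X, ℂ)) :
    ∃ A : ℝ, 0 ≤ A ∧ ∀ x : X,
      (∀ ξ : Fiber x, ∫ η, ‖kernel ω f ξ η‖ ∂(haar.measure x) ≤ A) ∧
      ∀ η : Fiber x, ∫ ξ, ‖kernel ω f ξ η‖ ∂(haar.measure x) ≤ A := by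
  obtain ⟨A, hA⟩ := exists_bound_integral haar f f.continuous f.hasCompactSupport
  have hinv : Continuous (Arrows.inv : Arrows X → Arrows X) := IsTopologicalGroupoid.continuous_inv
  obtain ⟨B, hB⟩ := exists_bound_integral haar (fun ξ => f ξ.inv) (f.continuous.comp hinv)
    (HasCompactSupport.intro (f.hasCompactSupport.isCompact.image hinv) fun ξ hξ =>
      image_eq_zero_of_notMem_tsupport fun h => hξ ⟨_, h, by simp [Arrows.inv]⟩)
  refine ⟨max 0 (max A B), le_max_left _ _, fun x => ⟨fun ξ => ?_, fun η => ?_⟩⟩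
  · refine le_trans (le_of_eq ?_) ((hB ξ.r).trans ((le_max_right _ _).trans (le_max_right _ _)))
    simp only [norm_kernel]
    have hc : Continuous (fun η : Fiber x => ‖f (ξ.quot η)‖) :=
      (f.continuous.comp (continuous_quot.comp (Continuous.prodMk_right ξ))).norm
    rw [← haar.map_mulRight ξ.hom, integral_map (continuous_mulRight ξ.hom).aemeasurable
      hc.aestronglyMeasurable]
    simp [Fiber.quot, Fiber.mulRight, Arrows.inv, Fiber.toArrows]
  · refine le_trans (le_of_eq ?_) ((hA η.r).trans ((le_max_left _ _).trans (le_max_right _ _)))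
    simp only [norm_kernel]
    have hc : Continuous (fun ξ : Fiber x => ‖f (ξ.quot η)‖) :=
      (f.continuous.comp (continuous_quot.comp (Continuous.prodMk_left η))).norm
    rw [← haar.map_mulRight η.hom, integral_map (continuous_mulRight η.hom).aemeasurable
      hc.aestronglyMeasurable]
    simp [Fiber.quot, Fiber.mulRight, Fiber.toArrows]

variable [T2Space (Arrows X)]

lemma kernel_proper_left (ω : TwoCocycle X) (f : C_c(Arrows X, ℂ)) {x : X} (L : Set (Fiber x))
    (hL : IsCompact L) : ∃ L' : Set (Fiber x), IsCompact L' ∧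
      ∀ ξ η, η ∈ L → kernel ω f ξ η ≠ 0 → ξ ∈ L' := by
  refine ⟨_, Fiber.isClosedEmbedding_toArrows.isCompact_preimage
    (isCompact_image_mul f.hasCompactSupport.isCompact
      (hL.image Fiber.continuous_toArrows)), fun ξ η hη h => ?_⟩
  refine ⟨ξ.quotPair η, ⟨subset_tsupport _ (left_ne_zero_of_mul h), ⟨η, hη, rfl⟩⟩, ?_⟩
  simp [Fiber.quotPair, Composable.mul, Fiber.toArrows]

lemma kernel_proper_right (ω : TwoCocycle X) (f : C_c(Arrows X, ℂ)) {x : X} (L : Set (Fiber x))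
    (hL : IsCompact L) : ∃ L' : Set (Fiber x), IsCompact L' ∧
      ∀ ξ η, ξ ∈ L → kernel ω f ξ η ≠ 0 → η ∈ L' := by
  refine ⟨_, Fiber.isClosedEmbedding_toArrows.isCompact_preimage
    (isCompact_image_mul
      (f.hasCompactSupport.isCompact.image IsTopologicalGroupoid.continuous_inv)
      (hL.image Fiber.continuous_toArrows)), fun ξ η hξ h => ?_⟩
  refine ⟨⟨Groupoid.inv (Groupoid.inv η.hom ≫ ξ.hom), ξ.hom⟩,
    ⟨⟨_, subset_tsupport _ (left_ne_zero_of_mul h), rfl⟩, ⟨ξ, hξ, rfl⟩⟩, ?_⟩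
  simp [Composable.mul, Fiber.toArrows]

variable [LocallyCompactSpace (Arrows X)] [SigmaCompactSpace (Arrows X)]

/-- `f ⋆_ω u` is well defined and square integrable for `u ∈ L²(Ξ_x; λ_x)`, with an `L²`-norm
controlled uniformly in `x`. -/
lemma exists_bound_conv (haar : RightHaarSystem X) (ω : TwoCocycle X) (f : C_c(Arrows X, ℂ)) :
    ∃ A : ℝ, 0 ≤ A ∧ ∀ (x : X) (u : haar.H x),
      MemLp (conv haar ω f u) 2 (haar.measure x) ∧
      eLpNorm (conv haar ω f u) 2 (haar.measure x) ≤
        ENNReal.ofReal A * eLpNorm u 2 (haar.measure x) ∧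
      ∀ ξ, Integrable (fun η => kernel ω f ξ η * u η) (haar.measure x) := by
  obtain ⟨A, hA, h⟩ := exists_bound_kernel haar ω f
  exact ⟨A, hA, fun x u => schur_test (haar.measure x) (continuous_kernel ω f x)
    (kernel_proper_left ω f) (kernel_proper_right ω f) hA (h x).1 (h x).2 (Lp.memLp u)⟩

lemma memLp_conv (haar : RightHaarSystem X) (ω : TwoCocycle X) (f : C_c(Arrows X, ℂ)) {x : X}
    (u : haar.H x) : MemLp (conv haar ω f u) 2 (haar.measure x) := by
  obtain ⟨A, -, h⟩ := exists_bound_conv haar ω f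
  exact (h x u).1

lemma integrable_kernel_mul (haar : RightHaarSystem X) (ω : TwoCocycle X) (f : C_c(Arrows X, ℂ))
    {x : X} (u : haar.H x) (ξ : Fiber x) :
    Integrable (fun η => kernel ω f ξ η * u η) (haar.measure x) := by
  obtain ⟨A, -, h⟩ := exists_bound_conv haar ω f
  exact (h x u).2.2 ξ

lemma norm_toLp_conv_le (haar : RightHaarSystem X) (ω : TwoCocycle X) (f : C_c(Arrows X, ℂ)) :
    ∃ A : ℝ, 0 ≤ A ∧ ∀ (x : X) (u : haar.H x), ‖(memLp_conv haar ω f u).toLp _‖ ≤ A * ‖u‖ := by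
  obtain ⟨A, hA, h⟩ := exists_bound_conv haar ω f
  refine ⟨A, hA, fun x u => ?_⟩
  rw [Lp.norm_toLp, Lp.norm_def, ← ENNReal.toReal_ofReal hA, ← ENNReal.toReal_mul]
  exact ENNReal.toReal_mono (ENNReal.mul_ne_top ENNReal.ofReal_ne_top (Lp.eLpNorm_ne_top u))
    (h x u).2.1

/-- The linear map `u ↦ f ⋆_ω u` on `L²(Ξ_x; λ_x)`. -/
def regRepLinear (haar : RightHaarSystem X) (ω : TwoCocycle X) (x : X) (f : C_c(Arrows X, ℂ)) :
    haar.H x →ₗ[ℂ] haar.H x where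
  toFun u := (memLp_conv haar ω f u).toLp _
  map_add' u w := by
    rw [← MemLp.toLp_add, MemLp.toLp_eq_toLp_iff]
    refine ae_of_all _ fun ξ => ?_
    rw [Pi.add_apply]
    simp only [conv]
    rw [← integral_add (integrable_kernel_mul haar ω f u ξ) (integrable_kernel_mul haar ω f w ξ)]
    refine integral_congr_ae ?_
    filter_upwards [Lp.coeFn_add u w] with η hη
    rw [hη, Pi.add_apply, mul_add]
  map_smul' c u := by
    rw [RingHom.id_apply, ← MemLp.toLp_const_smul, MemLp.toLp_eq_toLp_iff]
    refine ae_of_all _ fun ξ => ?_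
    rw [Pi.smul_apply]
    simp only [conv]
    rw [← integral_smul]
    refine integral_congr_ae ?_
    filter_upwards [Lp.coeFn_smul c u] with η hη
    rw [hη, Pi.smul_apply, smul_eq_mul, smul_eq_mul]
    ring

/-- The operator `Π_x(f) ∈ 𝔹(ℋ_x)`, `Π_x(f)u = f ⋆_ω u`, for `f ∈ C_c(Ξ)`. -/
def regRep (haar : RightHaarSystem X) (ω : TwoCocycle X) (x : X) (f : C_c(Arrows X, ℂ)) :
    haar.H x →L[ℂ] haar.H x :=
  (regRepLinear haar ω x f).mkContinuousOfExistsBound <| by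
    obtain ⟨A, -, h⟩ := norm_toLp_conv_le haar ω f
    exact ⟨A, h x⟩

lemma regRep_apply (haar : RightHaarSystem X) (ω : TwoCocycle X) (x : X) (f : C_c(Arrows X, ℂ))
    (u : haar.H x) : regRep haar ω x f u =ᵐ[haar.measure x] conv haar ω f u :=
  (memLp_conv haar ω f u).coeFn_toLp

lemma bddAbove_norm_regRep (haar : RightHaarSystem X) (ω : TwoCocycle X) (f : C_c(Arrows X, ℂ)) :
    BddAbove (Set.range fun x => ‖regRep haar ω x f‖) := by
  obtain ⟨A, hA, h⟩ := norm_toLp_conv_le haar ω f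
  refine ⟨A, ?_⟩
  rintro _ ⟨x, rfl⟩
  exact ContinuousLinearMap.opNorm_le_bound _ hA (h x)

/-! ### The reduced twisted groupoid `C*`-algebra -/

/-- The `C*`-algebra of bounded families `(T_x)_{x ∈ X}`, `T_x ∈ 𝔹(ℋ_x)`, with the pointwise
operations and `‖T‖ = sup_x ‖T_x‖`. -/
def BoundedFamilies (haar : RightHaarSystem X) : Type (max u v) :=
  lp (fun x : X => haar.H x →L[ℂ] haar.H x) ∞

instance (haar : RightHaarSystem X) : NonUnitalCStarAlgebra (BoundedFamilies haar) :=
  inferInstanceAs (NonUnitalCStarAlgebra (lp (fun x : X => haar.H x →L[ℂ] haar.H x) ∞))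

/-- Evaluation `T ↦ T_x` of bounded families. -/
def BoundedFamilies.eval (haar : RightHaarSystem X) (x : X) :
    BoundedFamilies haar →⋆ₙₐ[ℂ] (haar.H x →L[ℂ] haar.H x) where
  toFun T := T.1 x
  map_smul' _ _ := rfl
  map_zero' := rfl
  map_add' _ _ := rfl
  map_mul' _ _ := rfl
  map_star' _ := rfl

/-- The family `(Π_x(f))_{x ∈ X}`; its norm is the reduced norm `sup_x ‖Π_x(f)‖` of `f`. -/
def regFamily (haar : RightHaarSystem X) (ω : TwoCocycle X) (f : C_c(Arrows X, ℂ)) :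
    BoundedFamilies haar :=
  ⟨fun x => regRep haar ω x f, memℓp_infty (bddAbove_norm_regRep haar ω f)⟩

/-- The closed `*`-subalgebra generated by the families `(Π_x(f))_{x ∈ X}`, `f ∈ C_c(Ξ)`. -/
def reducedSubalgebra (haar : RightHaarSystem X) (ω : TwoCocycle X) :
    NonUnitalStarSubalgebra ℂ (BoundedFamilies haar) :=
  (NonUnitalStarAlgebra.adjoin ℂ (Set.range (regFamily haar ω))).topologicalClosure

/-- The reduced twisted groupoid `C*`-algebra `C*_r(Ξ, ω)`, i.e. the completion of `C_c(Ξ, ω)` in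
the reduced norm `‖f‖ = sup_x ‖Π_x(f)‖`, realized through the isometric embedding
`f ↦ (Π_x(f))_x` as a closed `*`-algebra of bounded families of operators. -/
def ReducedCStarAlgebra (haar : RightHaarSystem X) (ω : TwoCocycle X) : Type (max u v) :=
  reducedSubalgebra haar ω

instance (haar : RightHaarSystem X) (ω : TwoCocycle X) :
    IsClosed (reducedSubalgebra haar ω : Set (BoundedFamilies haar)) :=
  NonUnitalStarSubalgebra.isClosed_topologicalClosure _

instance (haar : RightHaarSystem X) (ω : TwoCocycle X) :
    NonUnitalCStarAlgebra (ReducedCStarAlgebra haar ω) :=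
  inferInstanceAs (NonUnitalCStarAlgebra (reducedSubalgebra haar ω))

/-- The regular representation `Π_x : C*_r(Ξ, ω) → 𝔹(ℋ_x)`, the continuous extension of
`C_c(Ξ) ∋ f ↦ Π_x(f)`. -/
def regularRepresentation (haar : RightHaarSystem X) (ω : TwoCocycle X) (x : X) :
    ReducedCStarAlgebra haar ω →⋆ₙₐ[ℂ] (haar.H x →L[ℂ] haar.H x) :=
  (BoundedFamilies.eval haar x).comp
    (NonUnitalStarSubalgebraClass.subtype (reducedSubalgebra haar ω))

end Rep

end TwistedGroupoid

end

open TwistedGroupoid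

/-!
The kernel of `Π_x` depends only on the orbit of `x`: a twisted right translation by an arrow
`x ⟶ y` intertwines `Π_x` with `Π_y` (`regRep_translation`), by invariance of the Haar system and
the cocycle identity.  Moreover the components of an element `a` of the reduced algebra vary
continuously: for `u ∈ C_c(Ξ)` the family `Π_x(a) u|_x` is a uniform limit of restrictions of
elements of `C_c(Ξ)`, so that `x ↦ ‖Π_x(a) u|_x‖` is continuous (`continuousFamilies`).  This
rests on the fact that the twisted convolution of elements of `C_c(Ξ)` is again in `C_c(Ξ)`
(`twistedConv`).  As the restrictions of `C_c(Ξ)` are dense in each `L²(Ξ_x)`, an element all of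
whose components over a dense orbit vanish is zero (`eq_zero_of_dense`), and density of the orbit
of `x` implies faithfulness of `Π_x`.  Conversely, if the orbit of `x` is not dense, a bump function
around a unit outside its closure, supported in arrows with range outside the closure, is a nonzero
element of the kernel of `Π_x` (`dense_orbit_of_injective`).

The spectral condition follows from faithfulness and nondegeneracy of `Π_x`
(`regularRepresentation_nondegenerate`) by spectral permanence
(`spectrum_map_eq_spectrum_multiplier`).  The idealizer of `Π_x(C*_r)` in the bounded operators is a
closed unital `*`-subalgebra which, by nondegeneracy, embeds in the multiplier algebra; hence
an element has the same spectrum in all three algebras.  Conversely, if `Π_x(a) = 0`, the spectral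
condition gives `a* a` the spectrum `{0}` in the multiplier algebra, whence `a = 0`
(`injective_of_spectrum_eq`).
-/

noncomputable section

namespace TwistedGroupoid

universe v u

/-! ### Spectra in multiplier algebras -/

section Multipliers

variable {A B : Type*} [NonUnitalCStarAlgebra A] [CStarAlgebra B]

/-- The idealizer of the image of a homomorphism `π : A → B` of `C*`-algebras with `B` unital: all
`b` for which `b` and `b*` multiply `π(A)` into itself from the left (and therefore also from the
right). -/
def idealizer (π : A →⋆ₙₐ[ℂ] B) : StarSubalgebra ℂ B where
  carrier := {b | ∀ a, b * π a ∈ Set.range π ∧ star b * π a ∈ Set.range π}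
  mul_mem' := by
    intro b c hb hc a
    obtain ⟨⟨a₁, h₁⟩, -⟩ := hc a
    obtain ⟨-, ⟨a₂, h₂⟩⟩ := hb a
    refine ⟨?_, ?_⟩
    · rw [mul_assoc, ← h₁]
      exact (hb a₁).1
    · rw [star_mul, mul_assoc, ← h₂]
      exact (hc a₂).2
  add_mem' := by
    intro b c hb hc a
    obtain ⟨⟨a₁, h₁⟩, ⟨a₂, h₂⟩⟩ := hb a
    obtain ⟨⟨a₃, h₃⟩, ⟨a₄, h₄⟩⟩ := hc a
    exact ⟨⟨a₁ + a₃, by rw [map_add, h₁, h₃, add_mul]⟩,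
      ⟨a₂ + a₄, by rw [map_add, h₂, h₄, star_add, add_mul]⟩⟩
  algebraMap_mem' := fun z a =>
    ⟨⟨z • a, by rw [map_smul, Algebra.smul_def]⟩,
      ⟨star z • a, by rw [map_smul, Algebra.smul_def, algebraMap_star_comm]⟩⟩
  star_mem' := fun {b} hb a => ⟨(hb a).2, by rw [star_star]; exact (hb a).1⟩

lemma map_mem_idealizer (π : A →⋆ₙₐ[ℂ] B) (a : A) : π a ∈ idealizer π := fun c =>
  ⟨⟨a * c, map_mul π a c⟩, ⟨star a * c, by rw [map_mul, map_star]⟩⟩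

lemma mul_mem_range_of_mem_idealizer {π : A →⋆ₙₐ[ℂ] B} {b : B} (hb : b ∈ idealizer π) (a : A) :
    π a * b ∈ Set.range π := by
  obtain ⟨c, hc⟩ := (hb (star a)).2
  exact ⟨star c, by rw [map_star, hc, star_mul, map_star, star_star, star_star]⟩

lemma isClosed_range_of_injective {π : A →⋆ₙₐ[ℂ] B} (hπ : Function.Injective π) :
    IsClosed (Set.range π) :=
  (NonUnitalStarAlgHom.isometry π hπ).isClosedEmbedding.isClosed_range

lemma isClosed_idealizer {π : A →⋆ₙₐ[ℂ] B} (hπ : Function.Injective π) :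
    IsClosed (idealizer π : Set B) := by
  have h := isClosed_range_of_injective hπ
  have : (idealizer π : Set B) = ⋂ a, ((fun b => b * π a) ⁻¹' Set.range π ∩
      (fun b => star b * π a) ⁻¹' Set.range π) := by
    ext b
    simp only [Set.mem_iInter]
    rfl
  rw [this]
  exact isClosed_iInter fun a =>
    (h.preimage (by fun_prop)).inter (h.preimage (by fun_prop))

/-- An injective homomorphism of `C*`-algebras as a linear isometry. -/
def isometryOfInjective (π : A →⋆ₙₐ[ℂ] B) (hπ : Function.Injective π) : A →ₗᵢ[ℂ] B where
  toFun := π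
  map_add' := map_add π
  map_smul' := map_smul π
  norm_map' := NonUnitalStarAlgHom.norm_map π hπ

/-- A bounded operator `T` of `B` that preserves the range of the injective homomorphism
`π : A → B`, transported to an operator of `A`. -/
def liftOfInjective (π : A →⋆ₙₐ[ℂ] B) (hπ : Function.Injective π) (T : B →L[ℂ] B)
    (hT : ∀ a, T (π a) ∈ Set.range π) : A →L[ℂ] A :=
  ((isometryOfInjective π hπ).equivRange.symm.toContinuousLinearEquiv : _ →L[ℂ] A) ∘L
    (T ∘L (isometryOfInjective π hπ).toContinuousLinearMap).codRestrict
      (LinearMap.range (isometryOfInjective π hπ).toLinearMap) hT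

lemma map_liftOfInjective (π : A →⋆ₙₐ[ℂ] B) (hπ : Function.Injective π) (T : B →L[ℂ] B)
    (hT : ∀ a, T (π a) ∈ Set.range π) (a : A) :
    π (liftOfInjective π hπ T hT a) = T (π a) := by
  have h := (isometryOfInjective π hπ).equivRange.apply_symm_apply
    ((T ∘L (isometryOfInjective π hπ).toContinuousLinearMap).codRestrict
      (LinearMap.range (isometryOfInjective π hπ).toLinearMap) hT a)
  exact congrArg Subtype.val h

lemma doubleCentralizer_ext {m n : 𝓜(ℂ, A)} (h₁ : ∀ a, m.fst a = n.fst a)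
    (h₂ : ∀ a, m.snd a = n.snd a) : m = n :=
  DoubleCentralizer.ext _ _ _ _ (Prod.ext (ContinuousLinearMap.ext h₁) (ContinuousLinearMap.ext h₂))

/-- The multiplier of `A` defined by an element of the idealizer of `π(A)`. -/
def multiplierOf (π : A →⋆ₙₐ[ℂ] B) (hπ : Function.Injective π) (b : idealizer π) : 𝓜(ℂ, A) where
  fst := liftOfInjective π hπ (ContinuousLinearMap.mul ℂ B b) fun a => (b.2 a).1
  snd := liftOfInjective π hπ ((ContinuousLinearMap.mul ℂ B).flip b) fun a =>
    mul_mem_range_of_mem_idealizer b.2 a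
  central := fun x y => hπ <| by
    have h₁ := map_liftOfInjective π hπ ((ContinuousLinearMap.mul ℂ B).flip b)
      (fun a => mul_mem_range_of_mem_idealizer b.2 a) x
    have h₂ := map_liftOfInjective π hπ (ContinuousLinearMap.mul ℂ B b) (fun a => (b.2 a).1) y
    rw [map_mul, map_mul, h₁, h₂]
    exact mul_assoc _ _ _

lemma map_multiplierOf_fst (π : A →⋆ₙₐ[ℂ] B) (hπ : Function.Injective π) (b : idealizer π)
    (a : A) : π ((multiplierOf π hπ b).fst a) = b * π a :=
  map_liftOfInjective ..

lemma map_multiplierOf_snd (π : A →⋆ₙₐ[ℂ] B) (hπ : Function.Injective π) (b : idealizer π)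
    (a : A) : π ((multiplierOf π hπ b).snd a) = π a * b :=
  map_liftOfInjective ..

/-- The homomorphism from the idealizer of `π(A)` to the multiplier algebra of `A`. -/
def idealizerToMultiplier (π : A →⋆ₙₐ[ℂ] B) (hπ : Function.Injective π) :
    idealizer π →⋆ₐ[ℂ] 𝓜(ℂ, A) where
  toFun := multiplierOf π hπ
  map_one' := doubleCentralizer_ext
    (fun a => hπ <| by simp [map_multiplierOf_fst])
    (fun a => hπ <| by simp [map_multiplierOf_snd])
  map_mul' b c := doubleCentralizer_ext
    (fun a => hπ <| by simp [map_multiplierOf_fst, mul_assoc])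
    (fun a => hπ <| by simp [map_multiplierOf_snd, mul_assoc])
  map_zero' := doubleCentralizer_ext
    (fun a => hπ <| by simp [map_multiplierOf_fst])
    (fun a => hπ <| by simp [map_multiplierOf_snd])
  map_add' b c := doubleCentralizer_ext
    (fun a => hπ <| by simp [map_multiplierOf_fst, add_mul])
    (fun a => hπ <| by simp [map_multiplierOf_snd, mul_add])
  commutes' z := doubleCentralizer_ext
    (fun a => hπ <| by simp [map_multiplierOf_fst, Algebra.algebraMap_eq_smul_one])
    (fun a => hπ <| by simp [map_multiplierOf_snd, Algebra.algebraMap_eq_smul_one])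
  map_star' b := doubleCentralizer_ext
    (fun a => hπ <| by
      simp [map_multiplierOf_fst, map_multiplierOf_snd, DoubleCentralizer.star_fst, map_star])
    (fun a => hπ <| by
      simp [map_multiplierOf_fst, map_multiplierOf_snd, DoubleCentralizer.star_snd, map_star])

/-- An injective homomorphism of unital `C*`-algebras detects invertibility. -/
lemma isUnit_map_iff_of_injective {C D : Type*} [CStarAlgebra C] [CStarAlgebra D]
    (Φ : C →⋆ₐ[ℂ] D) (hΦ : Function.Injective Φ) (c : C) : IsUnit (Φ c) ↔ IsUnit c := by
  refine ⟨fun h => ?_, fun h => h.map Φ⟩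
  have hcl : IsClosed (Φ.range : Set D) :=
    (NonUnitalStarAlgHom.isometry Φ hΦ).isClosedEmbedding.isClosed_range
  have h' : IsUnit (⟨Φ c, c, rfl⟩ : Φ.range) := (StarSubalgebra.coe_isUnit Φ.range).1 h
  obtain ⟨⟨_, e, rfl⟩, h₁, h₂⟩ := isUnit_iff_exists.1 h'
  refine isUnit_iff_exists.2 ⟨e, hΦ ?_, hΦ ?_⟩
  · rw [map_mul, map_one]
    exact congrArg Subtype.val h₁
  · rw [map_mul, map_one]
    exact congrArg Subtype.val h₂

/-- A nondegenerate faithful representation of a `C*`-algebra preserves spectra, if these are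
computed in the multiplier algebra.  Both algebras contain the idealizer of the image as a closed
unital `*`-subalgebra, so that spectral permanence applies twice. -/
theorem spectrum_map_eq_spectrum_multiplier (π : A →⋆ₙₐ[ℂ] B) (hπ : Function.Injective π)
    (hnd : ∀ b : B, (∀ a, b * π a = 0) → b = 0) (a : A) :
    spectrum ℂ (π a) = spectrum ℂ (a : 𝓜(ℂ, A)) := by
  have hcl := isClosed_idealizer hπ
  let c : idealizer π := ⟨π a, map_mem_idealizer π a⟩
  have hinj : Function.Injective (idealizerToMultiplier π hπ) := by
    refine (injective_iff_map_eq_zero _).2 fun b hb => Subtype.ext (hnd _ fun e => ?_)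
    rw [← map_multiplierOf_fst π hπ b e]
    have : multiplierOf π hπ b = 0 := hb
    simp [this]
  have hc : idealizerToMultiplier π hπ c = (a : 𝓜(ℂ, A)) := doubleCentralizer_ext
    (fun e => hπ <| (map_multiplierOf_fst π hπ c e).trans (by simp [c]))
    (fun e => hπ <| (map_multiplierOf_snd π hπ c e).trans (by simp [c]))
  have h₁ : spectrum ℂ c = spectrum ℂ (π a) := StarSubalgebra.spectrum_eq _
  rw [← h₁, ← hc]
  ext z
  rw [spectrum.mem_iff, spectrum.mem_iff, not_iff_not,
    ← isUnit_map_iff_of_injective _ hinj, map_sub, AlgHomClass.commutes]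

/-- A homomorphism of `C*`-algebras that preserves the spectra of normal elements, computed in the
multiplier algebra, is injective: if `π a = 0`, then `a* a` has spectrum `{0}`. -/
theorem injective_of_spectrum_eq [Nontrivial B] (π : A →⋆ₙₐ[ℂ] B)
    (h : ∀ a : A, IsStarNormal a → spectrum ℂ (π a) = spectrum ℂ (a : 𝓜(ℂ, A))) :
    Function.Injective π := by
  refine (injective_iff_map_eq_zero _).2 fun a ha => ?_
  have hs : IsSelfAdjoint (star a * a) := .star_mul_self a
  have h₁ := h (star a * a) hs.isStarNormal
  rw [map_mul, ha, mul_zero, spectrum.zero_eq] at h₁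
  have hs' : IsSelfAdjoint ((star a * a : A) : 𝓜(ℂ, A)) :=
    hs.map (DoubleCentralizer.coeHom (𝕜 := ℂ) (A := A))
  have h₂ : ((star a * a : A) : 𝓜(ℂ, A)) = 0 := by
    rw [← nnnorm_eq_zero, ← ENNReal.coe_eq_zero, ← hs'.spectralRadius_eq_nnnorm, spectralRadius,
      ← h₁]
    simp
  have h₃ : star a * a * (star a * a) = 0 := by
    have := congrArg (fun m : 𝓜(ℂ, A) => m.fst (star a * a)) h₂
    simpa using this
  rw [← CStarRing.star_mul_self_eq_zero_iff, ← CStarRing.star_mul_self_eq_zero_iff, hs.star_eq, h₃]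

end Multipliers

/-! ### Convolution and involution on `C_c(Ξ)` -/

section Convolution

lemma circle_conj_mul_self (z : Circle) : starRingEnd ℂ (z : ℂ) * z = 1 := by
  rw [← Circle.coe_inv_eq_conj, ← Circle.coe_mul, inv_mul_cancel, Circle.coe_one]

variable {X : Type u} [Groupoid.{v} X]

lemma Arrows.mk_eqToHom_comp {x : X} (ξ : Arrows X) (h : x = ξ.d) :
    (⟨eqToHom h ≫ ξ.hom⟩ : Arrows X) = ξ := by
  subst h
  simp

/-- The composable pair `(ξη⁻¹, η)` of two arrows `ξ, η` with the same source. -/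
def Composable.ofSameSource (p : {p : Arrows X × Arrows X // p.1.d = p.2.d}) : Composable X :=
  ⟨Groupoid.inv p.1.2.hom ≫ eqToHom p.2.symm ≫ p.1.1.hom, p.1.2.hom⟩

variable [TopologicalSpace (Arrows X)]

lemma kernel_unit_right (ω : TwoCocycle X) (f : Arrows X → ℂ) {x : X} (ξ : Fiber x) :
    kernel ω f ξ ⟨𝟙 x⟩ = f ξ.toArrows := by
  have e : Groupoid.inv (𝟙 x) ≫ ξ.hom = ξ.hom := by simp [Groupoid.inv_eq_inv]
  simp only [kernel, Fiber.quot, Fiber.quotPair, e, ω.unit_right, Circle.coe_one, mul_one]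
  rfl

variable [TopologicalSpace X] [IsTopologicalGroupoid X]

lemma Composable.continuous_ofSameSource :
    Continuous (Composable.ofSameSource : _ → Composable X) := by
  let q : {p : Arrows X × Arrows X // p.1.d = p.2.d} → Composable X := fun p =>
    ⟨eqToHom p.2.symm ≫ p.1.1.hom, Groupoid.inv p.1.2.hom⟩
  have hq : Continuous q := by
    refine continuous_induced_rng.2 ?_
    have : Composable.toProd ∘ q = fun p => (p.1.1, p.1.2.inv) := by
      funext p
      exact Prod.ext (Arrows.mk_eqToHom_comp _ _) rfl
    rw [this]
    have := IsTopologicalGroupoid.continuous_inv (X := X)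
    fun_prop
  refine continuous_induced_rng.2 ?_
  exact (IsTopologicalGroupoid.continuous_mul.comp hq).prodMk
    (continuous_snd.comp continuous_subtype_val)

lemma continuous_invPair :
    Continuous (fun ξ : Arrows X => (⟨Groupoid.inv ξ.hom, ξ.hom⟩ : Composable X)) :=
  continuous_induced_rng.2 (IsTopologicalGroupoid.continuous_inv.prodMk continuous_id)

variable [T2Space (Arrows X)]

/-- The twisted involution `f*(ξ) = conj (f(ξ⁻¹) ω(ξ⁻¹, ξ))` of `C_c(Ξ)`. -/
def involution (ω : TwoCocycle X) (f : C_c(Arrows X, ℂ)) : C_c(Arrows X, ℂ) where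
  toFun ξ := starRingEnd ℂ (f ξ.inv * (ω.toFun ⟨Groupoid.inv ξ.hom, ξ.hom⟩ : ℂ))
  continuous_toFun := Complex.continuous_conj.comp
    ((f.continuous.comp IsTopologicalGroupoid.continuous_inv).mul
      (continuous_subtype_val.comp (ω.continuous_toFun.comp continuous_invPair)))
  hasCompactSupport' := by
    refine HasCompactSupport.intro
      (f.hasCompactSupport.isCompact.image IsTopologicalGroupoid.continuous_inv) fun ξ hξ => ?_
    have : f ξ.inv = 0 := image_eq_zero_of_notMem_tsupport fun h =>
      hξ ⟨_, h, by simp [Arrows.inv]⟩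
    simp [this]

/-- The kernel of `f*` is the adjoint of the kernel of `f`.  This is the cocycle identity for
`(ηξ⁻¹, ξη⁻¹, η)`. -/
lemma kernel_involution (ω : TwoCocycle X) (f : C_c(Arrows X, ℂ)) {x : X} (ξ η : Fiber x) :
    kernel ω (involution ω f) ξ η = starRingEnd ℂ (kernel ω f η ξ) := by
  have h := ω.cocycle (Groupoid.inv (Groupoid.inv η.hom ≫ ξ.hom)) (Groupoid.inv η.hom ≫ ξ.hom) η.hom
  have e : Groupoid.inv (Groupoid.inv η.hom ≫ ξ.hom) = Groupoid.inv ξ.hom ≫ η.hom := by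
    simp [Groupoid.inv_eq_inv]
  have e' : η.hom ≫ Groupoid.inv η.hom ≫ ξ.hom = ξ.hom := by simp
  rw [Groupoid.comp_inv, ω.unit_left, mul_one, e', e] at h
  have h' : (ω.toFun ⟨Groupoid.inv ξ.hom ≫ η.hom, Groupoid.inv η.hom ≫ ξ.hom⟩ : ℂ) =
      ω.toFun ⟨Groupoid.inv η.hom ≫ ξ.hom, η.hom⟩ *
        ω.toFun ⟨Groupoid.inv ξ.hom ≫ η.hom, ξ.hom⟩ := by
    rw [h, Circle.coe_mul]
  have hc : starRingEnd ℂ (ω.toFun ⟨Groupoid.inv η.hom ≫ ξ.hom, η.hom⟩ : ℂ) *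
      (ω.toFun ⟨Groupoid.inv η.hom ≫ ξ.hom, η.hom⟩ : ℂ) = 1 :=
    circle_conj_mul_self _
  change starRingEnd ℂ (f ⟨Groupoid.inv (Groupoid.inv η.hom ≫ ξ.hom)⟩ *
    (ω.toFun ⟨Groupoid.inv (Groupoid.inv η.hom ≫ ξ.hom), Groupoid.inv η.hom ≫ ξ.hom⟩ : ℂ)) *
      (ω.toFun ⟨Groupoid.inv η.hom ≫ ξ.hom, η.hom⟩ : ℂ) =
    starRingEnd ℂ (f ⟨Groupoid.inv ξ.hom ≫ η.hom⟩ *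
      (ω.toFun ⟨Groupoid.inv ξ.hom ≫ η.hom, ξ.hom⟩ : ℂ))
  rw [e, h', map_mul, map_mul, map_mul]
  linear_combination starRingEnd ℂ (f ⟨Groupoid.inv ξ.hom ≫ η.hom⟩) *
    starRingEnd ℂ (ω.toFun ⟨Groupoid.inv ξ.hom ≫ η.hom, ξ.hom⟩ : ℂ) * hc

lemma hasCompactSupport_comp_toArrows {E : Type*} [Zero E]
    {u : Arrows X → E} (hu : HasCompactSupport u) (x : X) :
    HasCompactSupport (fun ξ : Fiber x => u ξ.toArrows) :=
  hu.comp_isClosedEmbedding Fiber.isClosedEmbedding_toArrows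

/-- Integrals over the fibres depend continuously on the fibre and on a parameter. -/
lemma continuous_integral_param [LocallyCompactSpace (Arrows X)]
    (haar : RightHaarSystem X) {Z : Type*}
    [TopologicalSpace Z] {G : Z → Arrows X → ℂ} (hG : Continuous G.uncurry)
    {K : Set (Arrows X)} (hK : IsCompact K) (hGK : ∀ z, ∀ η ∉ K, G z η = 0) :
    Continuous (fun p : Z × X => ∫ η : Fiber p.2, G p.1 η.toArrows ∂(haar.measure p.2)) := by
  have hGz : ∀ z, Continuous (G z) := fun z => hG.comp (Continuous.prodMk_right z)
  have hGc : ∀ z, HasCompactSupport (G z) := fun z => HasCompactSupport.intro hK (hGK z)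
  obtain ⟨χ, hχ1, -, hχc, hχ0⟩ := exists_continuous_one_zero_of_isCompact hK isClosed_empty
    (Set.disjoint_empty K)
  obtain ⟨A, hA⟩ := exists_bound_integral haar (fun ξ => (χ ξ : ℂ)) (by fun_prop)
    (hχc.comp_left (g := ((↑) : ℝ → ℂ)) Complex.ofReal_zero)
  have hint : ∀ z x, Integrable (fun η : Fiber x => G z η.toArrows) (haar.measure x) := fun z x =>
    ((hGz z).comp Fiber.continuous_toArrows).integrable_of_hasCompactSupport
      (hasCompactSupport_comp_toArrows (hGc z) x)
  rw [continuous_iff_continuousAt]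
  rintro ⟨z₀, x₀⟩
  refine Metric.continuousAt_iff'.2 fun ε hε => ?_
  obtain ⟨δ, hδ, hδA⟩ : ∃ δ : ℝ, 0 < δ ∧ δ * A < ε / 2 := by
    obtain ⟨δ, hδ, h⟩ := exists_pos_mul_lt (half_pos hε) A
    exact ⟨δ, hδ, by rwa [mul_comm]⟩
  obtain ⟨V, hV, hVδ⟩ : ∃ V ∈ 𝓝[Set.univ] z₀, ∀ z ∈ V, ∀ η ∈ K, dist (G z η) (G z₀ η) < δ :=
    hK.mem_uniformity_of_prod (f := G) hG.continuousOn (Set.mem_univ _)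
      (Metric.dist_mem_uniformity hδ)
  rw [nhdsWithin_univ] at hV
  -- split into the variation of `G z` on `K`, weighted by `χ`, and that of the measure
  have h₂ := Metric.continuousAt_iff'.1
    ((haar.continuous_integral (G z₀) (hGz z₀) (hGc z₀)).continuousAt (x := x₀)) (ε / 2)
      (half_pos hε)
  rw [nhds_prod_eq]
  filter_upwards [prod_mem_prod hV h₂] with p hp
  refine (dist_triangle _ _ _).trans_lt ((add_lt_add_of_le_of_lt ?_ hp.2).trans_eq (add_halves ε))
  rw [dist_eq_norm, ← integral_sub (hint _ _) (hint _ _)]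
  refine le_trans ?_ hδA.le
  refine le_trans ?_ (mul_le_mul_of_nonneg_left (hA p.2) hδ.le)
  rw [← integral_const_mul]
  refine norm_integral_le_of_norm_le ?_ (ae_of_all _ fun η => ?_)
  · refine Integrable.const_mul (Integrable.norm ?_) δ
    exact (Continuous.integrable_of_hasCompactSupport (by
      have := Fiber.continuous_toArrows (x := p.2)
      fun_prop)
      (hasCompactSupport_comp_toArrows
        (hχc.comp_left (g := ((↑) : ℝ → ℂ)) Complex.ofReal_zero) p.2))
  · by_cases hη : η.toArrows ∈ K
    · have := (hVδ p.1 hp.1 _ hη).le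
      rw [dist_eq_norm] at this
      simpa [hχ1 hη] using this
    · rw [hGK _ _ hη, hGK _ _ hη, sub_zero, norm_zero]
      positivity

/-- The kernel of `Π_x(f)` is, simultaneously for all `x`, the restriction of a continuous function
on `Ξ × Ξ`. -/
lemma exists_continuous_extension_kernel [LocallyCompactSpace (Arrows X)]
    [SigmaCompactSpace (Arrows X)] (ω : TwoCocycle X) (f : C_c(Arrows X, ℂ)) :
    ∃ E : C(Arrows X × Arrows X, ℂ), ∀ (x : X) (ξ η : Fiber x),
      E (ξ.toArrows, η.toArrows) = kernel ω f ξ η := by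
  have := t2Space_units X
  have hS : IsClosed {p : Arrows X × Arrows X | p.1.d = p.2.d} :=
    isClosed_eq (IsTopologicalGroupoid.continuous_d.comp continuous_fst)
      (IsTopologicalGroupoid.continuous_d.comp continuous_snd)
  have hF : Continuous (fun p : {p : Arrows X × Arrows X | p.1.d = p.2.d} =>
      f (Composable.ofSameSource p).toProd.1 * (ω.toFun (Composable.ofSameSource p) : ℂ)) := by
    have h := Composable.continuous_ofSameSource (X := X)
    exact (f.continuous.comp (continuous_fst.comp (continuous_induced_dom.comp h))).mul
      (continuous_subtype_val.comp (ω.continuous_toFun.comp h))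
  obtain ⟨E, hE⟩ := ContinuousMap.exists_restrict_eq hS ⟨_, hF⟩
  refine ⟨E, fun x ξ η => ?_⟩
  have h := DFunLike.congr_fun hE ⟨(ξ.toArrows, η.toArrows), rfl⟩
  have hp : Composable.ofSameSource ⟨(ξ.toArrows, η.toArrows), rfl⟩ = ξ.quotPair η := by
    simp [Composable.ofSameSource, Fiber.quotPair, Fiber.toArrows]
  refine h.trans ?_
  simp only [ContinuousMap.coe_mk]
  rw [hp]
  rfl

variable [LocallyCompactSpace (Arrows X)] [SigmaCompactSpace (Arrows X)]

/-- The twisted convolution `f ⋆_ω u` of two elements of `C_c(Ξ)`. -/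
def twistedConv (haar : RightHaarSystem X) (ω : TwoCocycle X) (f u : C_c(Arrows X, ℂ)) :
    C_c(Arrows X, ℂ) where
  toFun ξ := conv haar ω f (fun η : Fiber ξ.d => u η.toArrows) ⟨ξ.hom⟩
  continuous_toFun := by
    obtain ⟨E, hE⟩ := exists_continuous_extension_kernel ω f
    have h := continuous_integral_param haar (G := fun ξ η => E (ξ, η) * u η)
      (by
        change Continuous fun p : Arrows X × Arrows X => E (p.1, p.2) * u p.2
        exact E.continuous.mul (u.continuous.comp continuous_snd))
      u.hasCompactSupport.isCompact
      (fun z η hη => by rw [image_eq_zero_of_notMem_tsupport hη, mul_zero])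
    have h' := h.comp (continuous_id.prodMk (IsTopologicalGroupoid.continuous_d (X := X)))
    refine h'.congr fun ξ => ?_
    refine integral_congr_ae (ae_of_all _ fun η => ?_)
    have := hE ξ.d ⟨ξ.hom⟩ η
    simp only [← this]
    rfl
  hasCompactSupport' := by
    refine HasCompactSupport.intro
      (isCompact_image_mul f.hasCompactSupport.isCompact u.hasCompactSupport.isCompact)
      fun ξ hξ => ?_
    refine integral_eq_zero_of_ae (ae_of_all _ fun η => ?_)
    by_contra h0
    refine hξ ⟨Fiber.quotPair ⟨ξ.hom⟩ η, ⟨?_, ?_⟩, ?_⟩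
    · exact subset_tsupport _ (left_ne_zero_of_mul (left_ne_zero_of_mul h0))
    · exact subset_tsupport _ (right_ne_zero_of_mul h0)
    · simp [Fiber.quotPair, Composable.mul]

lemma twistedConv_apply (haar : RightHaarSystem X) (ω : TwoCocycle X) (f u : C_c(Arrows X, ℂ))
    {x : X} (ξ : Fiber x) : twistedConv haar ω f u ξ.toArrows =
      ∫ η : Fiber x, kernel ω f ξ η * u η.toArrows ∂(haar.measure x) :=
  rfl

end Convolution

/-! ### Restrictions of continuous functions to the fibres -/

section Restriction

variable {X : Type u} [Groupoid.{v} X] [TopologicalSpace (Arrows X)]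
  [TopologicalSpace X] [IsTopologicalGroupoid X] [T2Space (Arrows X)]

lemma memLp_restrict (haar : RightHaarSystem X) (u : C_c(Arrows X, ℂ)) (x : X) :
    MemLp (fun ξ : Fiber x => u ξ.toArrows) 2 (haar.measure x) :=
  (u.continuous.comp Fiber.continuous_toArrows).memLp_of_hasCompactSupport
    (hasCompactSupport_comp_toArrows u.hasCompactSupport x)

/-- The restriction of `u ∈ C_c(Ξ)` to the fibre `Ξ_x`, as an element of `L²(Ξ_x; λ_x)`. -/
def restrictL2 (haar : RightHaarSystem X) (u : C_c(Arrows X, ℂ)) (x : X) : haar.H x :=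
  (memLp_restrict haar u x).toLp _

lemma coeFn_restrictL2 (haar : RightHaarSystem X) (u : C_c(Arrows X, ℂ)) (x : X) :
    restrictL2 haar u x =ᵐ[haar.measure x] fun ξ => u ξ.toArrows :=
  MemLp.coeFn_toLp _

lemma restrictL2_eq_zero_iff (haar : RightHaarSystem X) (u : C_c(Arrows X, ℂ)) (x : X) :
    restrictL2 haar u x = 0 ↔ (fun ξ : Fiber x => u ξ.toArrows) =ᵐ[haar.measure x] fun _ => 0 := by
  rw [Lp.eq_zero_iff_ae_eq_zero]
  exact ⟨fun h => (coeFn_restrictL2 haar u x).symm.trans h,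
    fun h => (coeFn_restrictL2 haar u x).trans h⟩

lemma restrictL2_add (haar : RightHaarSystem X) (u w : C_c(Arrows X, ℂ)) (x : X) :
    restrictL2 haar (u + w) x = restrictL2 haar u x + restrictL2 haar w x :=
  rfl

lemma restrictL2_smul (haar : RightHaarSystem X) (c : ℂ) (u : C_c(Arrows X, ℂ)) (x : X) :
    restrictL2 haar (c • u) x = c • restrictL2 haar u x :=
  rfl

lemma inner_restrictL2 (haar : RightHaarSystem X) (u : C_c(Arrows X, ℂ)) {x : X} (h : haar.H x) :
    inner ℂ (restrictL2 haar u x) h =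
      ∫ ξ : Fiber x, starRingEnd ℂ (u ξ.toArrows) * h ξ ∂(haar.measure x) := by
  rw [L2.inner_def]
  refine integral_congr_ae ?_
  filter_upwards [coeFn_restrictL2 haar u x] with ξ hξ
  rw [hξ, RCLike.inner_apply, mul_comm]

lemma inner_restrictL2_restrictL2 (haar : RightHaarSystem X) (u w : C_c(Arrows X, ℂ)) (x : X) :
    inner ℂ (restrictL2 haar u x) (restrictL2 haar w x) =
      ∫ ξ : Fiber x, starRingEnd ℂ (u ξ.toArrows) * w ξ.toArrows ∂(haar.measure x) := by
  rw [inner_restrictL2]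
  refine integral_congr_ae ?_
  filter_upwards [coeFn_restrictL2 haar w x] with ξ hξ
  rw [hξ]

/-- The norms of the restrictions of `u` depend continuously on the fibre, since
`‖u|_x‖² = ∫ |u|² dλ_x`. -/
lemma continuous_norm_restrictL2 (haar : RightHaarSystem X) (u : C_c(Arrows X, ℂ)) :
    Continuous (fun x => ‖restrictL2 haar u x‖) := by
  have h := haar.continuous_integral (fun ξ => starRingEnd ℂ (u ξ) * u ξ)
    ((Complex.continuous_conj.comp u.continuous).mul u.continuous) u.hasCompactSupport.mul_left
  have h' : ∀ x, ‖restrictL2 haar u x‖ = √‖inner ℂ (restrictL2 haar u x) (restrictL2 haar u x)‖ :=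
    fun x => by
      rw [inner_self_eq_norm_sq_to_K, norm_pow, RCLike.norm_ofReal, abs_norm,
        Real.sqrt_sq (norm_nonneg _)]
  simp only [h', inner_restrictL2_restrictL2]
  fun_prop

lemma exists_norm_restrictL2_le (haar : RightHaarSystem X) (u : C_c(Arrows X, ℂ)) :
    ∃ C : ℝ, 0 ≤ C ∧ ∀ x, ‖restrictL2 haar u x‖ ≤ C := by
  have := t2Space_units X
  have hc : HasCompactSupport (fun x => ‖restrictL2 haar u x‖) := by
    refine HasCompactSupport.intro
      (u.hasCompactSupport.isCompact.image IsTopologicalGroupoid.continuous_d) fun x hx => ?_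
    rw [norm_eq_zero, restrictL2_eq_zero_iff]
    exact ae_of_all _ fun ξ => image_eq_zero_of_notMem_tsupport fun h => hx ⟨_, h, rfl⟩
  obtain ⟨C, hC⟩ := (continuous_norm_restrictL2 haar u).bounded_above_of_compact_support hc
  exact ⟨max C 0, le_max_right _ _, fun x => by simpa using Or.inl (hC x)⟩

/-- An element of `C_c(Ξ)` whose restriction to `Ξ_x` is null vanishes on `Ξ_x`. -/
lemma eq_zero_of_restrictL2_eq_zero (haar : RightHaarSystem X) {u : C_c(Arrows X, ℂ)} {x : X}
    (h : restrictL2 haar u x = 0) (ξ : Fiber x) : u ξ.toArrows = 0 := by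
  exact congrFun (Continuous.ae_eq_iff_eq _ (u.continuous.comp Fiber.continuous_toArrows)
    continuous_const |>.1 ((restrictL2_eq_zero_iff haar u x).1 h)) ξ

variable [LocallyCompactSpace (Arrows X)] [SigmaCompactSpace (Arrows X)]

/-- Continuous compactly supported functions on a fibre extend to elements of `C_c(Ξ)`. -/
lemma exists_extension_of_fiber {x : X} {g : Fiber x → ℂ} (hg : Continuous g)
    (hgc : HasCompactSupport g) : ∃ u : C_c(Arrows X, ℂ), ∀ ξ : Fiber x, u ξ.toArrows = g ξ := by
  obtain ⟨G, hG⟩ := ContinuousMap.exists_extension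
    (Fiber.isClosedEmbedding_toArrows (x := x)) ⟨g, hg⟩
  obtain ⟨χ, hχ1, -, hχc, -⟩ := exists_continuous_one_zero_of_isCompact
    (hgc.isCompact.image Fiber.continuous_toArrows) isClosed_empty (Set.disjoint_empty _)
  refine ⟨⟨⟨fun ξ => G ξ * (χ ξ : ℂ), by fun_prop⟩, ?_⟩, fun ξ => ?_⟩
  · exact (hχc.comp_left (g := ((↑) : ℝ → ℂ)) Complex.ofReal_zero).mul_left
  · have h : G ξ.toArrows = g ξ := DFunLike.congr_fun hG ξ
    change G ξ.toArrows * (χ ξ.toArrows : ℂ) = g ξ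
    rw [h]
    by_cases hξ : ξ ∈ tsupport g
    · simp [hχ1 ⟨ξ, hξ, rfl⟩]
    · simp [image_eq_zero_of_notMem_tsupport hξ]

/-- The restrictions of elements of `C_c(Ξ)` are dense in `L²(Ξ_x; λ_x)`. -/
lemma denseRange_restrictL2 (haar : RightHaarSystem X) (x : X) :
    DenseRange (fun u : C_c(Arrows X, ℂ) => restrictL2 haar u x) := by
  intro h
  refine EMetric.mem_closure_iff.2 fun ε hε => ?_
  obtain ⟨δ, hδ0, hδ⟩ := exists_between hε
  obtain ⟨g, hgc, hgh, hg, hgm⟩ := (Lp.memLp h).exists_hasCompactSupport_eLpNorm_sub_le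
    ENNReal.ofNat_ne_top hδ0.ne'
  obtain ⟨u, hu⟩ := exists_extension_of_fiber hg hgc
  refine ⟨_, ⟨u, rfl⟩, ?_⟩
  have : restrictL2 haar u x = hgm.toLp g := by
    simp only [restrictL2, hu]
  simp only [this]
  rw [Lp.edist_def]
  refine lt_of_le_of_lt (le_of_eq_of_le (eLpNorm_congr_ae ?_) hgh) hδ
  filter_upwards [hgm.coeFn_toLp] with ξ hξ
  simp [hξ]

lemma continuousLinearMap_ext_restrictL2 (haar : RightHaarSystem X) {x : X} {E : Type*}
    [NormedAddCommGroup E] [NormedSpace ℂ E] {S T : haar.H x →L[ℂ] E}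
    (h : ∀ u : C_c(Arrows X, ℂ), S (restrictL2 haar u x) = T (restrictL2 haar u x)) : S = T :=
  DFunLike.coe_injective <|
    (denseRange_restrictL2 haar x).equalizer S.continuous T.continuous (funext h)

/-- On restrictions of `u ∈ C_c(Ξ)`, the operators `Π_x(f)` are given by one element of `C_c(Ξ)`
for all `x`. -/
lemma regRep_restrictL2 (haar : RightHaarSystem X) (ω : TwoCocycle X) (f u : C_c(Arrows X, ℂ))
    (x : X) : regRep haar ω x f (restrictL2 haar u x) =
      restrictL2 haar (twistedConv haar ω f u) x := by
  refine Lp.ext ?_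
  filter_upwards [regRep_apply haar ω x f (restrictL2 haar u x),
    coeFn_restrictL2 haar (twistedConv haar ω f u) x] with ξ h₁ h₂
  rw [h₁, h₂, twistedConv_apply]
  refine integral_congr_ae ?_
  filter_upwards [coeFn_restrictL2 haar u x] with η hη
  rw [hη]

/-- `Π_x` is compatible with the involutions. -/
lemma star_regRep (haar : RightHaarSystem X) (ω : TwoCocycle X) (f : C_c(Arrows X, ℂ)) (x : X) :
    star (regRep haar ω x f) = regRep haar ω x (involution ω f) := by
  rw [ContinuousLinearMap.star_eq_adjoint]
  refine continuousLinearMap_ext_restrictL2 haar fun w => ?_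
  have h : ∀ u, inner ℂ u (ContinuousLinearMap.adjoint (regRep haar ω x f) (restrictL2 haar w x)) =
      inner ℂ u (regRep haar ω x (involution ω f) (restrictL2 haar w x)) := by
    refine congrFun ((denseRange_restrictL2 haar x).equalizer (by fun_prop) (by fun_prop) ?_)
    funext u
    simp only [Function.comp_apply, ContinuousLinearMap.adjoint_inner_right, regRep_restrictL2,
      inner_restrictL2_restrictL2, twistedConv_apply]
    have hu : Continuous (fun ξ : Fiber x => u ξ.toArrows) :=
      u.continuous.comp Fiber.continuous_toArrows
    have hw : Continuous (fun ξ : Fiber x => w ξ.toArrows) :=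
      w.continuous.comp Fiber.continuous_toArrows
    let G : Fiber x → Fiber x → ℂ := fun ξ η =>
      starRingEnd ℂ (kernel ω f ξ η * u η.toArrows) * w ξ.toArrows
    have hG : Continuous G.uncurry := by
      have hk : Continuous (fun p : Fiber x × Fiber x => kernel ω f p.1 p.2) :=
        continuous_kernel ω f x
      exact (Complex.continuous_conj.comp (hk.mul (hu.comp continuous_snd))).mul
        (hw.comp continuous_fst)
    have hGc : HasCompactSupport G.uncurry := by
      refine HasCompactSupport.intro
        ((hasCompactSupport_comp_toArrows w.hasCompactSupport x).isCompact.prod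
          (hasCompactSupport_comp_toArrows u.hasCompactSupport x).isCompact) ?_
      rintro ⟨ξ, η⟩ hp
      by_contra h0
      have h0' : starRingEnd ℂ (kernel ω f ξ η * u η.toArrows) * w ξ.toArrows ≠ 0 := h0
      rw [mul_ne_zero_iff, map_ne_zero, mul_ne_zero_iff] at h0'
      exact hp ⟨subset_tsupport (fun ξ : Fiber x => w ξ.toArrows) h0'.2,
        subset_tsupport (fun ξ : Fiber x => u ξ.toArrows) h0'.1.2⟩
    have hswap := integral_integral_swap_of_hasCompactSupport hG hGc
      (μ := haar.measure x) (ν := haar.measure x)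
    calc _ = ∫ ξ, ∫ η, G ξ η ∂(haar.measure x) ∂(haar.measure x) := by
          refine integral_congr_ae (ae_of_all _ fun ξ => ?_)
          simp only [G]
          rw [integral_mul_const, ← integral_conj]
      _ = ∫ η, ∫ ξ, G ξ η ∂(haar.measure x) ∂(haar.measure x) := hswap
      _ = _ := by
          refine integral_congr_ae (ae_of_all _ fun η => ?_)
          simp only [G]
          rw [← integral_const_mul]
          refine integral_congr_ae (ae_of_all _ fun ξ => ?_)
          simp only [kernel_involution, map_mul]
          ring
  exact ext_inner_left ℂ h

lemma star_regFamily (haar : RightHaarSystem X) (ω : TwoCocycle X) (f : C_c(Arrows X, ℂ)) :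
    star (regFamily haar ω f) = regFamily haar ω (involution ω f) :=
  Subtype.ext (funext fun x => star_regRep haar ω f x)

/-- A closed subalgebra that contains all families `(Π_x(f))_x`, `f ∈ C_c(Ξ)`, contains the reduced
`C*`-algebra; it need not be assumed to be closed under the involution. -/
lemma reducedSubalgebra_le (haar : RightHaarSystem X) (ω : TwoCocycle X)
    (M : NonUnitalSubalgebra ℂ (BoundedFamilies haar))
    (hM : IsClosed (M : Set (BoundedFamilies haar)))
    (h : ∀ f, regFamily haar ω f ∈ M) {T : BoundedFamilies haar}
    (hT : T ∈ reducedSubalgebra haar ω) : T ∈ M := by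
  refine closure_minimal (t := (M : Set (BoundedFamilies haar))) (fun S hS => ?_) hM hT
  have hS' : S ∈ (NonUnitalStarAlgebra.adjoin ℂ
      (Set.range (regFamily haar ω))).toNonUnitalSubalgebra := hS
  rw [NonUnitalStarAlgebra.adjoin_toNonUnitalSubalgebra] at hS'
  refine NonUnitalAlgebra.adjoin_le ?_ hS'
  rintro R (⟨f, rfl⟩ | ⟨f, hf⟩)
  · exact h f
  · rw [← star_star R, ← hf, star_regFamily]
    exact h _

end Restriction

/-! ### Continuity of the components of elements of the reduced algebra -/

section Continuity

variable {X : Type u} [Groupoid.{v} X] [TopologicalSpace (Arrows X)]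
  [TopologicalSpace X]

lemma norm_eval_le (haar : RightHaarSystem X) (x : X) (T : BoundedFamilies haar) :
    ‖BoundedFamilies.eval haar x T‖ ≤ ‖T‖ :=
  NonUnitalStarAlgHom.norm_apply_le _ T

lemma continuous_eval (haar : RightHaarSystem X) (x : X) :
    Continuous (BoundedFamilies.eval haar x) :=
  AddMonoidHomClass.continuous_of_bound (BoundedFamilies.eval haar x) 1 fun T => by
    rw [one_mul]
    exact norm_eval_le haar x T

variable [IsTopologicalGroupoid X] [T2Space (Arrows X)]

/-- A family `s` of vectors `s_x ∈ ℋ_x` is a uniform limit of families of restrictions of elements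
of `C_c(Ξ)`. -/
def IsUniformLimit (haar : RightHaarSystem X) (s : ∀ x, haar.H x) : Prop :=
  ∀ ε > 0, ∃ u : C_c(Arrows X, ℂ), ∀ x, ‖s x - restrictL2 haar u x‖ ≤ ε

lemma isUniformLimit_restrictL2 (haar : RightHaarSystem X) (u : C_c(Arrows X, ℂ)) :
    IsUniformLimit haar (restrictL2 haar u) :=
  fun ε hε => ⟨u, fun x => by rw [sub_self, norm_zero]; exact hε.le⟩

lemma IsUniformLimit.of_approx {haar : RightHaarSystem X} {s : ∀ x, haar.H x}
    (h : ∀ ε > 0, ∃ t, IsUniformLimit haar t ∧ ∀ x, ‖s x - t x‖ ≤ ε) : IsUniformLimit haar s := by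
  intro ε hε
  obtain ⟨t, ht, hst⟩ := h (ε / 2) (half_pos hε)
  obtain ⟨u, hu⟩ := ht (ε / 2) (half_pos hε)
  refine ⟨u, fun x => ?_⟩
  calc ‖s x - restrictL2 haar u x‖ ≤ ‖s x - t x‖ + ‖t x - restrictL2 haar u x‖ :=
        norm_sub_le_norm_sub_add_norm_sub _ _ _
    _ ≤ ε := by linarith [hst x, hu x]

lemma IsUniformLimit.add {haar : RightHaarSystem X} {s t : ∀ x, haar.H x}
    (hs : IsUniformLimit haar s) (ht : IsUniformLimit haar t) :
    IsUniformLimit haar (fun x => s x + t x) := by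
  intro ε hε
  obtain ⟨u, hu⟩ := hs (ε / 2) (half_pos hε)
  obtain ⟨w, hw⟩ := ht (ε / 2) (half_pos hε)
  refine ⟨u + w, fun x => ?_⟩
  rw [restrictL2_add, add_sub_add_comm]
  exact (norm_add_le _ _).trans (by linarith [hu x, hw x])

lemma IsUniformLimit.smul {haar : RightHaarSystem X} {s : ∀ x, haar.H x}
    (hs : IsUniformLimit haar s) (c : ℂ) : IsUniformLimit haar (fun x => c • s x) := by
  intro ε hε
  obtain ⟨u, hu⟩ := hs (ε / (‖c‖ + 1)) (by positivity)
  refine ⟨c • u, fun x => ?_⟩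
  rw [restrictL2_smul, ← smul_sub, norm_smul]
  calc ‖c‖ * ‖s x - restrictL2 haar u x‖ ≤ (‖c‖ + 1) * (ε / (‖c‖ + 1)) := by
        gcongr
        · linarith
        · exact hu x
    _ = ε := by field_simp

lemma IsUniformLimit.continuous_norm {haar : RightHaarSystem X} {s : ∀ x, haar.H x}
    (hs : IsUniformLimit haar s) : Continuous (fun x => ‖s x‖) := by
  refine continuous_of_uniform_approx_of_continuous fun V hV => ?_
  obtain ⟨ε, hε, hεV⟩ := Metric.mem_uniformity_dist.1 hV
  obtain ⟨u, hu⟩ := hs (ε / 2) (half_pos hε)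
  refine ⟨_, continuous_norm_restrictL2 haar u, fun x => hεV ?_⟩
  rw [Real.dist_eq]
  exact ((abs_norm_sub_norm_le _ _).trans (hu x)).trans_lt (half_lt_self hε)

/-- The bounded families of operators that map restrictions of elements of `C_c(Ξ)` to uniform
limits of such restrictions. -/
def continuousFamilies (haar : RightHaarSystem X) :
    NonUnitalSubalgebra ℂ (BoundedFamilies haar) where
  carrier := {T | ∀ u : C_c(Arrows X, ℂ),
    IsUniformLimit haar fun x => BoundedFamilies.eval haar x T (restrictL2 haar u x)}
  add_mem' {S T} hS hT u := by
    simpa only [map_add, add_apply] using (hS u).add (hT u)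
  zero_mem' u := by
    simp only [map_zero, zero_apply]
    exact isUniformLimit_restrictL2 haar 0
  smul_mem' c T hT u := by
    simpa only [map_smul, smul_apply] using (hT u).smul c
  mul_mem' {S T} hS hT u := by
    refine IsUniformLimit.of_approx fun ε hε => ?_
    obtain ⟨w, hw⟩ := hT u (ε / (‖S‖ + 1)) (by positivity)
    refine ⟨_, hS w, fun x => ?_⟩
    rw [map_mul, mul_apply_eq_comp, ← map_sub]
    calc _ ≤ ‖BoundedFamilies.eval haar x S‖ * _ := ContinuousLinearMap.le_opNorm _ _
      _ ≤ (‖S‖ + 1) * (ε / (‖S‖ + 1)) := by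
          gcongr
          · exact (norm_eval_le haar x S).trans (by linarith)
          · exact hw x
      _ = ε := by field_simp

lemma isClosed_continuousFamilies (haar : RightHaarSystem X) :
    IsClosed (continuousFamilies haar : Set (BoundedFamilies haar)) := by
  refine isClosed_of_closure_subset fun T hT u => IsUniformLimit.of_approx fun ε hε => ?_
  obtain ⟨C, hC, hu⟩ := exists_norm_restrictL2_le haar u
  obtain ⟨S, hS, hTS⟩ := Metric.mem_closure_iff.1 hT (ε / (C + 1)) (by positivity)
  refine ⟨_, hS u, fun x => ?_⟩
  rw [dist_eq_norm] at hTS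
  rw [← sub_apply, ← map_sub]
  calc _ ≤ ‖BoundedFamilies.eval haar x (T - S)‖ * _ := ContinuousLinearMap.le_opNorm _ _
    _ ≤ (ε / (C + 1)) * (C + 1) := by
        gcongr
        · exact (norm_eval_le haar x _).trans hTS.le
        · exact (hu x).trans (by linarith)
    _ = ε := by field_simp

variable [LocallyCompactSpace (Arrows X)] [SigmaCompactSpace (Arrows X)]

/-- An element of the reduced `C*`-algebra whose components vanish on a dense set of units is
zero. -/
lemma eq_zero_of_dense (haar : RightHaarSystem X) (ω : TwoCocycle X)
    (a : ReducedCStarAlgebra haar ω) {D : Set X} (hD : Dense D)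
    (h : ∀ y ∈ D, regularRepresentation haar ω y a = 0) : a = 0 := by
  have ha : a.1 ∈ continuousFamilies haar :=
    reducedSubalgebra_le haar ω _ (isClosed_continuousFamilies haar) (fun f u => by
      have h₀ : (fun x => regRep haar ω x f (restrictL2 haar u x)) =
          restrictL2 haar (twistedConv haar ω f u) := funext (regRep_restrictL2 haar ω f u)
      change IsUniformLimit haar fun x => regRep haar ω x f (restrictL2 haar u x)
      rw [h₀]
      exact isUniformLimit_restrictL2 haar _) a.2
  refine Subtype.ext (Subtype.ext (funext fun y => ?_))
  change regularRepresentation haar ω y a = 0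
  refine continuousLinearMap_ext_restrictL2 haar fun u => ?_
  have h₀ := congrFun (Continuous.ext_on hD (ha u).continuous_norm continuous_const
    (g := fun _ => (0 : ℝ)) fun y hy => by
      have := h y hy
      change ‖regularRepresentation haar ω y a _‖ = 0
      rw [this, zero_apply, norm_zero]) y
  exact norm_eq_zero.1 h₀

end Continuity

/-! ### Equivalence of the regular representations along an orbit -/

section Translation

lemma integral_eq_integral_comp {Y Z : Type*} [MeasurableSpace Y] [MeasurableSpace Z]
    {μ : Measure Y} {ν : Measure Z} {φ : Y → Z} (hφ : MeasurePreserving φ μ ν) {F : Z → ℂ}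
    (hF : AEStronglyMeasurable F ν) : ∫ z, F z ∂ν = ∫ y, F (φ y) ∂μ := by
  rw [← hφ.map_eq] at hF ⊢
  exact integral_map hφ.measurable.aemeasurable hF

variable {X : Type u} [Groupoid.{v} X] [TopologicalSpace (Arrows X)]

lemma continuous_cocycle_mulRight (ω : TwoCocycle X) {x y : X} (ξ : x ⟶ y) :
    Continuous (fun η : Fiber y => (ω.toFun ⟨η.hom, ξ⟩ : ℂ)) := by
  refine continuous_subtype_val.comp (ω.continuous_toFun.comp (continuous_induced_rng.2 ?_))
  have h0 : Continuous (fun _ : Fiber y => (⟨ξ⟩ : Arrows X)) := continuous_const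
  exact Fiber.continuous_toArrows.prodMk h0

/-- The cocycle identity for `(ηζ⁻¹, ζ, ξ)`, in terms of kernels. -/
lemma kernel_mulRight (ω : TwoCocycle X) (f : Arrows X → ℂ) {x y : X} (ξ : x ⟶ y)
    (η ζ : Fiber y) :
    starRingEnd ℂ (ω.toFun ⟨η.hom, ξ⟩ : ℂ) * kernel ω f (η.mulRight ξ) (ζ.mulRight ξ) =
      kernel ω f η ζ * starRingEnd ℂ (ω.toFun ⟨ζ.hom, ξ⟩ : ℂ) := by
  have h := ω.cocycle (Groupoid.inv ζ.hom ≫ η.hom) ζ.hom ξ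
  have e₁ : ζ.hom ≫ Groupoid.inv ζ.hom ≫ η.hom = η.hom := by simp
  have e₂ : Groupoid.inv (ξ ≫ ζ.hom) ≫ ξ ≫ η.hom = Groupoid.inv ζ.hom ≫ η.hom := by
    simp [Groupoid.inv_eq_inv]
  rw [e₁] at h
  have h' := congrArg (fun z : Circle => (z : ℂ)) h
  simp only [Circle.coe_mul] at h'
  simp only [kernel, Fiber.quot, Fiber.quotPair, Fiber.mulRight, e₂]
  have h₁ := circle_conj_mul_self (ω.toFun ⟨η.hom, ξ⟩)
  have h₂ := circle_conj_mul_self (ω.toFun ⟨ζ.hom, ξ⟩)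
  linear_combination (-f ⟨Groupoid.inv ζ.hom ≫ η.hom⟩ *
    starRingEnd ℂ (ω.toFun ⟨η.hom, ξ⟩ : ℂ) * starRingEnd ℂ (ω.toFun ⟨ζ.hom, ξ⟩ : ℂ)) * h' +
    (f ⟨Groupoid.inv ζ.hom ≫ η.hom⟩ * ω.toFun ⟨Groupoid.inv ζ.hom ≫ η.hom, ζ.hom⟩ *
      starRingEnd ℂ (ω.toFun ⟨ζ.hom, ξ⟩ : ℂ)) * h₁ -
    (f ⟨Groupoid.inv ζ.hom ≫ η.hom⟩ * starRingEnd ℂ (ω.toFun ⟨η.hom, ξ⟩ : ℂ) *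
      ω.toFun ⟨Groupoid.inv ζ.hom ≫ η.hom, ξ ≫ ζ.hom⟩) * h₂

variable [TopologicalSpace X] [IsTopologicalGroupoid X]

lemma measurePreserving_mulRight (haar : RightHaarSystem X) {x y : X} (ξ : x ⟶ y) :
    MeasurePreserving (Fiber.mulRight ξ) (haar.measure y) (haar.measure x) :=
  ⟨(continuous_mulRight ξ).measurable, haar.map_mulRight ξ⟩

lemma memLp_translation (haar : RightHaarSystem X) (ω : TwoCocycle X) {x y : X} (ξ : x ⟶ y)
    {h : Fiber x → ℂ} (hh : MemLp h 2 (haar.measure x)) :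
    MemLp (fun η : Fiber y => starRingEnd ℂ (ω.toFun ⟨η.hom, ξ⟩ : ℂ) * h (η.mulRight ξ)) 2
      (haar.measure y) := by
  have h₁ := hh.comp_measurePreserving (measurePreserving_mulRight haar ξ)
  refine h₁.of_le ?_ (ae_of_all _ fun η => ?_)
  · exact (Complex.continuous_conj.comp
      (continuous_cocycle_mulRight ω ξ)).aestronglyMeasurable.mul h₁.aestronglyMeasurable
  · rw [norm_mul, RCLike.norm_conj, Circle.norm_coe, one_mul, Function.comp_apply]

/-- The twisted right translation `L²(Ξ_x) → L²(Ξ_y)` by `ξ : x ⟶ y`, given by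
`(Rh)(η) = conj (ω(η, ξ)) h(ηξ)`. -/
def translation (haar : RightHaarSystem X) (ω : TwoCocycle X) {x y : X} (ξ : x ⟶ y) :
    haar.H x →L[ℂ] haar.H y :=
  LinearMap.mkContinuous
    { toFun := fun h => (memLp_translation haar ω ξ (Lp.memLp h)).toLp _
      map_add' := fun g h => by
        rw [← MemLp.toLp_add, MemLp.toLp_eq_toLp_iff]
        filter_upwards [(measurePreserving_mulRight haar ξ).quasiMeasurePreserving.ae
          (Lp.coeFn_add g h)] with η hη
        simp only [Pi.add_apply] at hη ⊢
        rw [hη, mul_add]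
      map_smul' := fun c h => by
        rw [RingHom.id_apply, ← MemLp.toLp_const_smul, MemLp.toLp_eq_toLp_iff]
        filter_upwards [(measurePreserving_mulRight haar ξ).quasiMeasurePreserving.ae
          (Lp.coeFn_smul c h)] with η hη
        simp only [Pi.smul_apply, smul_eq_mul] at hη ⊢
        rw [hη]
        ring } 1 fun h => by
    rw [one_mul]
    change ‖(memLp_translation haar ω ξ (Lp.memLp h)).toLp _‖ ≤ ‖h‖
    rw [Lp.norm_toLp, Lp.norm_def]
    refine le_of_eq (congrArg _ ?_)
    rw [← eLpNorm_comp_measurePreserving (Lp.aestronglyMeasurable h)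
      (measurePreserving_mulRight haar ξ)]
    refine eLpNorm_congr_norm_ae (ae_of_all _ fun η => ?_)
    rw [norm_mul, RCLike.norm_conj, Circle.norm_coe, one_mul, Function.comp_apply]

lemma coeFn_translation (haar : RightHaarSystem X) (ω : TwoCocycle X) {x y : X} (ξ : x ⟶ y)
    (h : haar.H x) : translation haar ω ξ h =ᵐ[haar.measure y]
      fun η => starRingEnd ℂ (ω.toFun ⟨η.hom, ξ⟩ : ℂ) * h (η.mulRight ξ) :=
  (memLp_translation haar ω ξ (Lp.memLp h)).coeFn_toLp

lemma translation_surjective (haar : RightHaarSystem X) (ω : TwoCocycle X) {x y : X} (ξ : x ⟶ y) :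
    Function.Surjective (translation haar ω ξ) := by
  intro g
  have hmp := measurePreserving_mulRight haar (Groupoid.inv ξ)
  have hc := (continuous_cocycle_mulRight ω ξ).comp (continuous_mulRight (Groupoid.inv ξ))
  have hg := (Lp.memLp g).comp_measurePreserving hmp
  have hm : MemLp (fun η : Fiber x => (ω.toFun ⟨(η.mulRight (Groupoid.inv ξ)).hom, ξ⟩ : ℂ) *
      g (η.mulRight (Groupoid.inv ξ))) 2 (haar.measure x) := by
    refine hg.of_le (hc.aestronglyMeasurable.mul hg.aestronglyMeasurable)
      (ae_of_all _ fun η => ?_)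
    rw [norm_mul, Circle.norm_coe, one_mul, Function.comp_apply]
  -- the preimage is `η ↦ ω(ηξ⁻¹, ξ) g(ηξ⁻¹)`
  refine ⟨hm.toLp _, Lp.ext ?_⟩
  filter_upwards [coeFn_translation haar ω ξ (hm.toLp _),
    (measurePreserving_mulRight haar ξ).quasiMeasurePreserving.ae hm.coeFn_toLp] with η h₁ h₂
  have e : (η.mulRight ξ).mulRight (Groupoid.inv ξ) = η := by
    simp [Fiber.mulRight]
  rw [h₁, h₂, e, ← mul_assoc, circle_conj_mul_self, one_mul]

/-- The bounded families of operators that commute with the twisted right translation by `ξ`. -/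
def commutingFamilies (haar : RightHaarSystem X) (ω : TwoCocycle X) {x y : X} (ξ : x ⟶ y) :
    NonUnitalSubalgebra ℂ (BoundedFamilies haar) where
  carrier := {T | ∀ h, BoundedFamilies.eval haar y T (translation haar ω ξ h) =
    translation haar ω ξ (BoundedFamilies.eval haar x T h)}
  add_mem' {S T} hS hT h := by
    simp only [map_add, add_apply, hS h, hT h]
  zero_mem' h := by
    simp only [map_zero, zero_apply]
  smul_mem' c T hT h := by
    simp only [map_smul, smul_apply, hT h]
  mul_mem' {S T} hS hT h := by
    simp only [map_mul, mul_apply_eq_comp, hT h, hS _]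

lemma isClosed_commutingFamilies (haar : RightHaarSystem X) (ω : TwoCocycle X) {x y : X}
    (ξ : x ⟶ y) : IsClosed (commutingFamilies haar ω ξ : Set (BoundedFamilies haar)) := by
  have hx := continuous_eval haar x
  have hy := continuous_eval haar y
  have : (commutingFamilies haar ω ξ : Set (BoundedFamilies haar)) =
      ⋂ h, {T | BoundedFamilies.eval haar y T (translation haar ω ξ h) =
        translation haar ω ξ (BoundedFamilies.eval haar x T h)} := by
    ext T
    simp only [Set.mem_iInter]
    rfl
  rw [this]
  exact isClosed_iInter fun h => isClosed_eq (by fun_prop) (by fun_prop)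

variable [T2Space (Arrows X)] [LocallyCompactSpace (Arrows X)] [SigmaCompactSpace (Arrows X)]

/-- Twisted right translations intertwine the regular representations. -/
lemma regRep_translation (haar : RightHaarSystem X) (ω : TwoCocycle X) {x y : X} (ξ : x ⟶ y)
    (f : C_c(Arrows X, ℂ)) (h : haar.H x) :
    regRep haar ω y f (translation haar ω ξ h) = translation haar ω ξ (regRep haar ω x f h) := by
  refine Lp.ext ?_
  have hmp := measurePreserving_mulRight haar ξ
  filter_upwards [regRep_apply haar ω y f (translation haar ω ξ h),
    coeFn_translation haar ω ξ (regRep haar ω x f h),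
    hmp.quasiMeasurePreserving.ae (regRep_apply haar ω x f h)] with η h₁ h₂ h₃
  rw [h₁, h₂, h₃, conv, conv]
  have hint := integrable_kernel_mul haar ω f h (η.mulRight ξ)
  rw [integral_eq_integral_comp hmp hint.aestronglyMeasurable, ← integral_const_mul]
  refine integral_congr_ae ?_
  filter_upwards [coeFn_translation haar ω ξ h] with ζ hζ
  rw [hζ, ← mul_assoc, ← mul_assoc, kernel_mulRight]

/-- The kernel of `Π_x` is contained in the kernel of `Π_y` if `y` lies in the orbit of `x`. -/
lemma regularRepresentation_eq_zero_of_mem_orbit (haar : RightHaarSystem X) (ω : TwoCocycle X)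
    (a : ReducedCStarAlgebra haar ω) {x y : X} (hy : y ∈ orbit x)
    (h : regularRepresentation haar ω x a = 0) : regularRepresentation haar ω y a = 0 := by
  obtain ⟨⟨ξ⟩, rfl⟩ := hy
  have ha : a.1 ∈ commutingFamilies haar ω ξ :=
    reducedSubalgebra_le haar ω _ (isClosed_commutingFamilies haar ω ξ)
      (fun f => regRep_translation haar ω ξ f) a.2
  refine ContinuousLinearMap.ext fun g => ?_
  obtain ⟨g, rfl⟩ := translation_surjective haar ω ξ g
  refine (ha g).trans ?_
  change translation haar ω ξ (regularRepresentation haar ω x a g) = _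
  rw [h, zero_apply, map_zero, zero_apply]

end Translation

/-! ### Nondegeneracy and faithfulness of the regular representations -/

section Faithfulness

variable {X : Type u} [Groupoid.{v} X] [TopologicalSpace (Arrows X)]
  [TopologicalSpace X] [IsTopologicalGroupoid X] [T2Space (Arrows X)]

lemma conv_involution_unit (haar : RightHaarSystem X) (ω : TwoCocycle X) (f : C_c(Arrows X, ℂ))
    {x : X} (h : Fiber x → ℂ) : conv haar ω (involution ω f) h ⟨𝟙 x⟩ =
      ∫ η : Fiber x, starRingEnd ℂ (f η.toArrows) * h η ∂(haar.measure x) := by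
  simp only [conv, kernel_involution, kernel_unit_right]

variable [LocallyCompactSpace (Arrows X)]

/-- Convolutions of elements of `C_c(Ξ)` with square integrable functions are continuous. -/
lemma continuous_conv (haar : RightHaarSystem X) (ω : TwoCocycle X) (f : C_c(Arrows X, ℂ)) {x : X}
    (h : haar.H x) : Continuous (conv haar ω f h) := by
  -- near a point the kernels have their supports in the second variable in one compact set
  refine continuous_iff_continuousAt.2 fun ξ => ?_
  obtain ⟨L, hL, hξL⟩ := exists_compact_mem_nhds ξ
  obtain ⟨L', hL', hk⟩ := kernel_proper_right ω f L hL
  have h₁ : IntegrableOn h L' (haar.measure x) :=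
    ((Lp.memLp h).locallyIntegrable (by norm_num)).integrableOn_isCompact hL'
  have h₂ := continuousOn_integral_bilinear_of_locally_integrable_of_compact_support
    (ContinuousLinearMap.mul ℂ ℂ).flip (f := fun ξ η => kernel ω f ξ η) (s := L) hL'
    (continuous_kernel ω f x).continuousOn
    (fun ξ η hξ hη => by
      by_contra h0
      exact hη (hk ξ η hξ h0)) h₁
  exact h₂.continuousAt hξL

variable [SigmaCompactSpace (Arrows X)]

/-- The element of `C*_r(Ξ, ω)` defined by `f ∈ C_c(Ξ)`. -/
def ofCompactlySupported (haar : RightHaarSystem X) (ω : TwoCocycle X) (f : C_c(Arrows X, ℂ)) :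
    ReducedCStarAlgebra haar ω :=
  ⟨regFamily haar ω f, NonUnitalStarSubalgebra.le_topologicalClosure _
    (NonUnitalStarAlgebra.subset_adjoin ℂ _ ⟨f, rfl⟩)⟩

lemma regularRepresentation_ofCompactlySupported (haar : RightHaarSystem X) (ω : TwoCocycle X)
    (f : C_c(Arrows X, ℂ)) (x : X) :
    regularRepresentation haar ω x (ofCompactlySupported haar ω f) = regRep haar ω x f :=
  rfl

/-- A vector annihilated by all `Π_x(f)` is zero.  The continuous function `f* ⋆ h` vanishes, and
its value at the unit `x` is the inner product of the restriction of `f` with `h`. -/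
lemma eq_zero_of_regRep_eq_zero (haar : RightHaarSystem X) (ω : TwoCocycle X) {x : X}
    (h : haar.H x) (hh : ∀ f, regRep haar ω x f h = 0) : h = 0 := by
  have h₀ : ∀ u : C_c(Arrows X, ℂ), inner ℂ (restrictL2 haar u x) h = 0 := by
    intro u
    rw [inner_restrictL2, ← conv_involution_unit]
    have hae : conv haar ω (involution ω u) h =ᵐ[haar.measure x] fun _ => 0 := by
      refine (regRep_apply haar ω x (involution ω u) h).symm.trans ?_
      rw [hh]
      exact Lp.coeFn_zero _ _ _
    exact congrFun ((continuous_conv haar ω _ h).ae_eq_iff_eq _ continuous_const |>.1 hae) _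
  have h₁ : ∀ g : haar.H x, inner ℂ g h = 0 := by
    refine congrFun ((denseRange_restrictL2 haar x).equalizer (g := fun g => inner ℂ g h)
      (h := fun _ => (0 : ℂ)) (by fun_prop) continuous_const (funext h₀))
  exact inner_self_eq_zero.1 (h₁ h)

/-- The representation `Π_x` is nondegenerate. -/
lemma regularRepresentation_nondegenerate (haar : RightHaarSystem X) (ω : TwoCocycle X) (x : X)
    (b : haar.H x →L[ℂ] haar.H x) (hb : ∀ a, b * regularRepresentation haar ω x a = 0) : b = 0 := by
  rw [← star_eq_zero]
  refine ContinuousLinearMap.ext fun g => ?_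
  refine eq_zero_of_regRep_eq_zero haar ω _ fun f => ?_
  have h := congrArg star (hb (star (ofCompactlySupported haar ω f)))
  rw [star_mul, map_star, star_star, star_zero, regularRepresentation_ofCompactlySupported] at h
  exact congrArg (fun T : haar.H x →L[ℂ] haar.H x => T g) h

/-- The canonical map from `C_c(Ξ)` to `C*_r(Ξ, ω)` is injective. -/
lemma eq_zero_of_ofCompactlySupported_eq_zero (haar : RightHaarSystem X) (ω : TwoCocycle X)
    {f : C_c(Arrows X, ℂ)} (hf : ofCompactlySupported haar ω f = 0) (x : X) :
    f (Arrows.unit x) = 0 := by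
  have h₀ : regRep haar ω x f = 0 := by
    rw [← regularRepresentation_ofCompactlySupported, hf, map_zero]
  -- the value of `f* ⋆ f` at the unit `x` is the squared norm of the restriction of `f` to `Ξ_x`
  have h₁ : restrictL2 haar (twistedConv haar ω (involution ω f) f) x = 0 := by
    rw [← regRep_restrictL2, ← star_regRep, h₀, star_zero, zero_apply]
  have h₂ : inner ℂ (restrictL2 haar f x) (restrictL2 haar f x) = 0 := by
    rw [inner_restrictL2_restrictL2, ← conv_involution_unit]
    exact eq_zero_of_restrictL2_eq_zero haar h₁ ⟨𝟙 x⟩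
  exact eq_zero_of_restrictL2_eq_zero haar (inner_self_eq_zero.1 h₂) ⟨𝟙 x⟩

lemma nontrivial_H (haar : RightHaarSystem X) (x : X) : Nontrivial (haar.H x) := by
  obtain ⟨χ, hχ1, -, hχc, -⟩ := exists_continuous_one_zero_of_isCompact
    (isCompact_singleton (x := Arrows.unit x)) isClosed_empty (Set.disjoint_empty _)
  let u : C_c(Arrows X, ℂ) := ⟨⟨fun ξ => (χ ξ : ℂ), by fun_prop⟩,
    hχc.comp_left (g := ((↑) : ℝ → ℂ)) Complex.ofReal_zero⟩
  refine ⟨restrictL2 haar u x, 0, fun h => ?_⟩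
  have h₁ := eq_zero_of_restrictL2_eq_zero haar h ⟨𝟙 x⟩
  have h₂ : u (Arrows.unit x) = 1 := by
    change (χ (Arrows.unit x) : ℂ) = 1
    rw [hχ1 rfl]
    simp
  exact one_ne_zero (h₂.symm.trans h₁)

/-- If `Π_x` is faithful, then the orbit of `x` is dense: an element of `C_c(Ξ)` that vanishes
on all arrows with range in the closure of the orbit is annihilated by `Π_x`. -/
lemma dense_orbit_of_injective (haar : RightHaarSystem X) (ω : TwoCocycle X) {x : X}
    (h : Function.Injective (regularRepresentation haar ω x)) : Dense (orbit x) := by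
  intro y
  by_contra hy
  have hcl : IsClosed ((fun ξ : Arrows X => ξ.r) ⁻¹' closure (orbit x)) :=
    isClosed_closure.preimage IsTopologicalGroupoid.continuous_r
  obtain ⟨χ, hχ1, hχ0, hχc, -⟩ := exists_continuous_one_zero_of_isCompact
    (isCompact_singleton (x := Arrows.unit y)) hcl (Set.disjoint_singleton_left.2 hy)
  let f : C_c(Arrows X, ℂ) := ⟨⟨fun ξ => (χ ξ : ℂ), by fun_prop⟩,
    hχc.comp_left (g := ((↑) : ℝ → ℂ)) Complex.ofReal_zero⟩
  have hf : regRep haar ω x f = 0 := by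
    refine ContinuousLinearMap.ext fun g => Lp.ext ?_
    refine (regRep_apply haar ω x f g).trans (EventuallyEq.trans ?_ (Lp.coeFn_zero _ _ _).symm)
    refine ae_of_all _ fun ξ => integral_eq_zero_of_ae (ae_of_all _ fun η => ?_)
    have : χ (ξ.quot η) = 0 := hχ0 (subset_closure ⟨ξ, rfl⟩)
    have hfk : f (ξ.quot η) = 0 := by
      change (χ (ξ.quot η) : ℂ) = 0
      rw [this, Complex.ofReal_zero]
    simp [kernel, hfk]
  have h₀ : ofCompactlySupported haar ω f = 0 := h <| by
    rw [regularRepresentation_ofCompactlySupported, hf, map_zero]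
  have h₁ := eq_zero_of_ofCompactlySupported_eq_zero haar ω h₀ y
  have h₂ : f (Arrows.unit y) = 1 := by
    change (χ (Arrows.unit y) : ℂ) = 1
    rw [hχ1 rfl]
    simp
  exact one_ne_zero (h₂.symm.trans h₁)

end Faithfulness

end TwistedGroupoid

end

theorem proposition3p7 {X : Type*} [Groupoid X] [TopologicalSpace X]
    [TopologicalSpace (Arrows X)] [IsTopologicalGroupoid X]
    [T2Space (Arrows X)] [LocallyCompactSpace (Arrows X)] [SigmaCompactSpace (Arrows X)]
    (haar : RightHaarSystem X) (ω : TwoCocycle X)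
    (htrans : IsTopologicallyTransitive X) (x : X) :
    List.TFAE [
      Dense (orbit x),
      Function.Injective (regularRepresentation haar ω x),
      ∀ f : ReducedCStarAlgebra haar ω, IsStarNormal f →
        spectrum ℂ (regularRepresentation haar ω x f) =
          spectrum ℂ (f : 𝓜(ℂ, ReducedCStarAlgebra haar ω))] := by
  tfae_have 1 → 2 := fun h => (injective_iff_map_eq_zero _).2 fun a ha =>
    eq_zero_of_dense haar ω a h fun y hy =>
      regularRepresentation_eq_zero_of_mem_orbit haar ω a hy ha
  tfae_have 2 → 1 := dense_orbit_of_injective haar ω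
  tfae_have 2 → 3 := fun h f _ => spectrum_map_eq_spectrum_multiplier _ h
    (regularRepresentation_nondegenerate haar ω x) f
  tfae_have 3 → 2 := fun h => by
    have := nontrivial_H haar x
    exact injective_of_spectrum_eq _ h
  tfae_finish
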